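/- Theorem (PTAS). Notation. For $n\ge 2$, $\mathbb S_n$ is the set of rankings of $[n]$, i.e. of permutations $\sigma=(\sigma_1,\dots,\sigma_n)$, where $\sigma_i$ is the candidate in position $i$ (position $1$ is the best); $c>_\sigma a$ means that $\sigma$ ranks $c$ above $a$, and $x^{\downarrow,\sigma}=\{y: x>_\sigma y\}$. For $S\subseteq[n]$ let $M(S,\sigma)$ be the set consisting of the $\sigma$-best element of $S$. For $\beta=(\beta_k)_{k\ge2}$ and a measure $\mu$ on $[n]$, put $$\mathrm d^\mu_\beta(\sigma,\pi)=\sum_{S\subseteq[n],\,|S|\ge2}\beta_{|S|}\,\mu\big(M(S,\sigma)\triangle M(S,\pi)\big),\qquad f_\beta(t)=\sum_{k=2}^n\beta_k\binom{t}{k-1},$$ $$\mathrm d^\mu_\beta(\sigma,\pi;b,t)=\sum_{i=b}^{t}\Big[f_\beta(n-i)\big(\mu(\sigma_i)+\mu(\pi_i)\big)-2f_\beta\big(|\sigma_i^{\downarrow,\sigma}\cap\sigma_i^{\downarrow,\pi}|\big)\mu(\sigma_i)\Big]$$ (an empty sum if $t<b$). For a profile $V=(v^1,\dots,v^m)\in\mathbb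 S_n^m$, $m\ge1$, put $\mathrm d^\mu_\beta(\sigma,V)=\sum_j\mathrm d^\mu_\beta(\sigma,v^j)$ and $\mathrm d^\mu_\beta(\sigma,V;b,t)=\sum_j\mathrm d^\mu_\beta(\sigma,v^j;b,t)$. Algorithm MyopicTop, with input $K\ge1$, $V$, $\beta\ge 0$ and $\mu\ge 0$: start with $Q=[n]$ and $i=1$. While some $c\in Q$ is preferred to all other elements of $Q$ by more than $m/2$ voters, set $\sigma_i=c$, remove $c$ from $Q$ and increase $i$ by $1$. Then replace $K$ by $\min\{K,|Q|\}$ and return any ranking $\sigma^{\mathrm{apx}}$ that minimises $\omega\mapsto\mathrm d^\mu_\beta(\omega,V;i,i+K-1)$ over the rankings $\omega$ with $\omega_k=\sigma_k$ for all $k<i$. Claim. There are a program $P$ for a random access machine with real arithmetic (unit cost for assignments of constants, array accesses, additions and subtractions of natural numbers, additions, subtractions and multiplications of real numbers, and comparisons) that implements Algorithm MyopicTop, i.e. on each input (with $n\ge2$, $m\ge1$) it halts with a possible output of the algorithm, and an absolute constant $C$ such that the following holds. Let $\beta_k\ge0$ for all $k\ge2$, $\beta_2>0$, and, writing $$h(K)=\sup_{t\ge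 \max(K,2)}\frac{\sum_{j=2}^{t-K}\beta_j\binom{t-K}{j}}{\sum_{j=0}^{t-2}\beta_{j+2}\binom{t-2}{j}}\in[0,\infty],$$ suppose that $\lim_{K\to\infty}h(K)=0$. For each $k\ge2$ let $\mu^{(k)}$ be a measure on $[k]$ with $0<u\le\mu^{(k)}_i\le U<\infty$ for all $i$ and $k$. For $\delta>0$ let $g(1/\delta)=\min\{K\ge1: h(K)\le\delta\}$. Fix $\epsilon>0$ and let $K=g\big(\tfrac{12U}{u\epsilon}\big)$; this minimum exists. Then for all $n\ge2$, $m\ge1$ and $V\in\mathbb S_n^m$: 1. every possible output $\sigma^{\mathrm{apx}}$ of Algorithm MyopicTop on the input $K$, $V$, $(\beta_k)_{k=2}^n$, $\mu^{(n)}$ satisfies $$\mathrm d^{\mu^{(n)}}_\beta(\sigma^{\mathrm{apx}},V)\le(1+\epsilon)\,\mathrm d^{\mu^{(n)}}_\beta(\sigma^*,V)$$ for every $\sigma^*$ that minimises $\mathrm d^{\mu^{(n)}}_\beta(\cdot,V)$ over $\mathbb S_n$; 2. on this input $P$ halts, with a possible output of Algorithm MyopicTop, after at most $C\,n^{K+1}mK$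 steps. -/

import Mathlib

open Filter Topology
open scoped ENNReal

namespace RankAgg

noncomputable section

/-! ## Rankings and top-difference distances

A ranking of `n` candidates is a permutation `σ` of `Fin n`; `σ p` is the candidate in
position `p` (position `0` is the most favoured one). -/

/-- `c >_σ a`: the ranking `σ` prefers the candidate `c` to the candidate `a`. -/
def Prefers {n : ℕ} (σ : Equiv.Perm (Fin n)) (c a : Fin n) : Prop :=
  σ.symm c < σ.symm a

instance {n : ℕ} (σ : Equiv.Perm (Fin n)) (c a : Fin n) : Decidable (Prefers σ c a) :=
  inferInstanceAs (Decidable (σ.symm c < σ.symm a))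

/-- The candidates to which `σ` prefers `x`. -/
def below {n : ℕ} (σ : Equiv.Perm (Fin n)) (x : Fin n) : Finset (Fin n) :=
  Finset.univ.filter fun y => Prefers σ x y

/-- `M(S, σ)`: the set of `σ`-maximal elements of the menu `S`. -/
def best {n : ℕ} (S : Finset (Fin n)) (σ : Equiv.Perm (Fin n)) : Finset (Fin n) :=
  S.filter fun x => ∀ y ∈ S, y ≠ x → Prefers σ x y

/-- The `(β, μ)`-top-difference distance: the sum, over all menus `S` with at least two elements,
of `β_{|S|} · μ(M(S,σ) ∆ M(S,π))`. Only the values `β 2, …, β n` matter. -/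
def topDist {n : ℕ} (β : ℕ → ℝ) (μ : Fin n → ℝ) (σ π : Equiv.Perm (Fin n)) : ℝ :=
  ∑ S ∈ (Finset.univ : Finset (Finset (Fin n))).filter (fun S => 2 ≤ S.card),
    β S.card * ∑ x ∈ symmDiff (best S σ) (best S π), μ x

/-- The cumulative distance of `σ` to the profile `V`. -/
def profileDist {n m : ℕ} (β : ℕ → ℝ) (μ : Fin n → ℝ) (σ : Equiv.Perm (Fin n))
    (V : Fin m → Equiv.Perm (Fin n)) : ℝ :=
  ∑ j, topDist β μ σ (V j)

/-- `σ` is a consensus (median) ranking of the profile `V`. -/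
def IsConsensus {n m : ℕ} (β : ℕ → ℝ) (μ : Fin n → ℝ) (V : Fin m → Equiv.Perm (Fin n))
    (σ : Equiv.Perm (Fin n)) : Prop :=
  ∀ π : Equiv.Perm (Fin n), profileDist β μ σ V ≤ profileDist β μ π V

/-- `f_β(t) = ∑_{k=2}^n β_k * binom(t, k-1)`. -/
def fBeta (n : ℕ) (β : ℕ → ℝ) (t : ℕ) : ℝ :=
  ∑ k ∈ Finset.Icc 2 n, β k * (t.choose (k - 1) : ℝ)

/-- The top-difference truncation to the positions `b, …, t`, where positions are numbered from `1`
(so `p : Fin n` is position `p + 1`). It is `0` if `t < b`. -/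
def truncDist {n : ℕ} (β : ℕ → ℝ) (μ : Fin n → ℝ) (σ π : Equiv.Perm (Fin n)) (b t : ℕ) : ℝ :=
  ∑ p ∈ (Finset.univ : Finset (Fin n)).filter (fun p : Fin n => b ≤ (p : ℕ) + 1 ∧ (p : ℕ) + 1 ≤ t),
    (fBeta n β (n - ((p : ℕ) + 1)) * (μ (σ p) + μ (π p))
      - 2 * fBeta n β (below σ (σ p) ∩ below π (σ p)).card * μ (σ p))

/-- The truncated distance of `σ` to the profile `V`. -/
def profileTruncDist {n m : ℕ} (β : ℕ → ℝ) (μ : Fin n → ℝ) (σ : Equiv.Perm (Fin n))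
    (V : Fin m → Equiv.Perm (Fin n)) (b t : ℕ) : ℝ :=
  ∑ j, truncDist β μ σ (V j) b t

/-! ## Algorithm MyopicTop -/

/-- `c ∈ Q`, and strictly more than half of the voters prefer `c` to every other element of `Q`. -/
def IsMajority {n m : ℕ} (V : Fin m → Equiv.Perm (Fin n)) (Q : Finset (Fin n)) (c : Fin n) : Prop :=
  c ∈ Q ∧ (m : ℝ) / 2 <
    ((Finset.univ.filter fun j : Fin m => ∀ a ∈ Q.erase c, Prefers (V j) c a).card : ℝ)

/-- The states that the while-loop reaches: the list of the candidates placed so far (best first)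
and the set `Q` of the remaining candidates. -/
inductive LoopReaches {n m : ℕ} (V : Fin m → Equiv.Perm (Fin n)) :
    List (Fin n) → Finset (Fin n) → Prop
  | start : LoopReaches V [] Finset.univ
  | step {l : List (Fin n)} {Q : Finset (Fin n)} {c : Fin n} :
      LoopReaches V l Q → IsMajority V Q c → LoopReaches V (l ++ [c]) (Q.erase c)

/-- The ranking `ω` starts with the list `l`. -/
def StartsWith {n : ℕ} (ω : Equiv.Perm (Fin n)) (l : List (Fin n)) : Prop :=
  ∀ (p : Fin n) (h : (p : ℕ) < l.length), ω p = l[(p : ℕ)]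

/-- `ω` is a possible output of Algorithm MyopicTop on the input `K, V, β, μ`: when the while-loop
stops, with candidates `l` placed and candidates `Q` remaining, `ω` minimises the distance to `V`
truncated to the positions `|l| + 1, …, |l| + min K |Q|` among all rankings that start with `l`. -/
def IsMyopicTopOutput {n m : ℕ} (K : ℕ) (V : Fin m → Equiv.Perm (Fin n)) (β : ℕ → ℝ)
    (μ : Fin n → ℝ) (ω : Equiv.Perm (Fin n)) : Prop :=
  ∃ (l : List (Fin n)) (Q : Finset (Fin n)),
    LoopReaches V l Q ∧ (¬ ∃ c, IsMajority V Q c) ∧ StartsWith ω l ∧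
    ∀ ω' : Equiv.Perm (Fin n), StartsWith ω' l →
      profileTruncDist β μ ω V (l.length + 1) (l.length + min K Q.card) ≤
        profileTruncDist β μ ω' V (l.length + 1) (l.length + min K Q.card)

/-! ## The growth rate and the truncation depth -/

/-- The supremum over `t ≥ max K 2` of
`(∑_{j=2}^{t-K} β_j binom(t-K, j)) / (∑_{j=0}^{t-2} β_{j+2} binom(t-2, j))`, in `[0, ∞]`
(the quotients are non-negative for non-negative weights). -/
def growthSup (β : ℕ → ℝ) (K : ℕ) : ℝ≥0∞ :=
  ⨆ (t : ℕ) (_ : max K 2 ≤ t), ENNReal.ofReal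
    ((∑ j ∈ Finset.Icc 2 (t - K), β j * ((t - K).choose j : ℝ)) /
      (∑ j ∈ Finset.Icc 0 (t - 2), β (j + 2) * ((t - 2).choose j : ℝ)))

/-- The truncation depths `K ≥ 1` that are admissible for the accuracy `δ`. -/
def depthSet (β : ℕ → ℝ) (δ : ℝ) : Set ℕ :=
  {K | 1 ≤ K ∧ growthSup β K ≤ ENNReal.ofReal δ}

/-- The function `g`, which sends `1/δ` to the least admissible depth for the accuracy `δ`. -/
def depth (β : ℕ → ℝ) (x : ℝ) : ℕ :=
  sInf (depthSet β (1 / x))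

end

end RankAgg

/-! ## A random access machine with real arithmetic

Programs have natural and real registers and natural and real arrays, all addressed by natural
numbers; an array cell is addressed through a natural register. Each elementary operation and each
evaluation of a test takes one step. There is no multiplication of natural numbers, and no
conversion of a real number to a natural number. -/

namespace RealRAM

noncomputable section

/-- The memory. `natArr A i` and `realArr A i` are the `i`-th cells of the arrays numbered `A`. -/
structure Store where
  nat : ℕ → ℕ
  real : ℕ → ℝ
  natArr : ℕ → ℕ → ℕ
  realArr : ℕ → ℕ → ℝ

/-- Elementary operations. The numbers `x, y, z` name registers and `A` names an array. -/
inductive Op where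
  /-- `x := c` -/
  | natConst (x c : ℕ)
  /-- `x := y + z` -/
  | natAdd (x y z : ℕ)
  /-- `x := y - z`, cut off at `0` -/
  | natSub (x y z : ℕ)
  /-- `x := A[y]` -/
  | natLoad (x A y : ℕ)
  /-- `A[x] := y` -/
  | natStore (A x y : ℕ)
  /-- `x := c`, for a real register `x` -/
  | realConst (x c : ℕ)
  /-- `x := y + z`, for real registers -/
  | realAdd (x y z : ℕ)
  /-- `x := y - z`, for real registers -/
  | realSub (x y z : ℕ)
  /-- `x := y * z`, for real registers -/
  | realMul (x y z : ℕ)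
  /-- `x := A[y]`, for a real register `x`, a real array `A` and a natural register `y` -/
  | realLoad (x A y : ℕ)
  /-- `A[x] := y`, for a real array `A`, a natural register `x` and a real register `y` -/
  | realStore (A x y : ℕ)

/-- The effect of an elementary operation. -/
def Op.apply : Op → Store → Store
  | .natConst x c, s => { s with nat := Function.update s.nat x c }
  | .natAdd x y z, s => { s with nat := Function.update s.nat x (s.nat y + s.nat z) }
  | .natSub x y z, s => { s with nat := Function.update s.nat x (s.nat y - s.nat z) }
  | .natLoad x A y, s => { s with nat := Function.update s.nat x (s.natArr A (s.nat y)) }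
  | .natStore A x y, s =>
      let row := Function.update (s.natArr A) (s.nat x) (s.nat y)
      { s with natArr := Function.update s.natArr A row }
  | .realConst x c, s => { s with real := Function.update s.real x (c : ℝ) }
  | .realAdd x y z, s => { s with real := Function.update s.real x (s.real y + s.real z) }
  | .realSub x y z, s => { s with real := Function.update s.real x (s.real y - s.real z) }
  | .realMul x y z, s => { s with real := Function.update s.real x (s.real y * s.real z) }
  | .realLoad x A y, s => { s with real := Function.update s.real x (s.realArr A (s.nat y)) }
  | .realStore A x y, s =>
      let row := Function.update (s.realArr A) (s.nat x) (s.real y)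
      { s with realArr := Function.update s.realArr A row }

/-- Tests: strict comparison of two registers. -/
inductive Test where
  | natLt (x y : ℕ)
  | realLt (x y : ℕ)

/-- The truth of a test. -/
def Test.Holds : Test → Store → Prop
  | .natLt x y, s => s.nat x < s.nat y
  | .realLt x y, s => s.real x < s.real y

/-- Programs. -/
inductive Program where
  | op (o : Op)
  | seq (P Q : Program)
  | ite (b : Test) (P Q : Program)
  | loop (b : Test) (P : Program)

/-- `Exec P s s' t`: started in the memory `s`, the program `P` halts in the memory `s'` after
exactly `t` steps. -/
inductive Exec : Program → Store → Store → ℕ → Prop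
  | op (o : Op) (s : Store) : Exec (.op o) s (o.apply s) 1
  | seq {P Q : Program} {s₀ s₁ s₂ : Store} {t₁ t₂ : ℕ} :
      Exec P s₀ s₁ t₁ → Exec Q s₁ s₂ t₂ → Exec (.seq P Q) s₀ s₂ (t₁ + t₂)
  | iteTrue {b : Test} {P Q : Program} {s₀ s₁ : Store} {t : ℕ} :
      b.Holds s₀ → Exec P s₀ s₁ t → Exec (.ite b P Q) s₀ s₁ (t + 1)
  | iteFalse {b : Test} {P Q : Program} {s₀ s₁ : Store} {t : ℕ} :
      ¬ b.Holds s₀ → Exec Q s₀ s₁ t → Exec (.ite b P Q) s₀ s₁ (t + 1)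
  | loopTrue {b : Test} {P : Program} {s₀ s₁ s₂ : Store} {t₁ t₂ : ℕ} :
      b.Holds s₀ → Exec P s₀ s₁ t₁ → Exec (.loop b P) s₁ s₂ t₂ →
        Exec (.loop b P) s₀ s₂ (t₁ + t₂ + 1)
  | loopFalse {b : Test} {P : Program} {s₀ : Store} :
      ¬ b.Holds s₀ → Exec (.loop b P) s₀ s₀ 1

/-- The memory that holds the input `K, V, β, μ` and is `0` elsewhere: the natural registers `0, 1, 2`
hold `n, m, K`; cell `j * n + p` of the natural array `0` holds the candidate in position `p` of
voter `j`; the real array `0` holds `β 2, …, β n` in the cells `2, …, n`; the real array `1`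
holds `μ`. -/
def inputStore {n m : ℕ} (K : ℕ) (V : Fin m → Equiv.Perm (Fin n)) (β : ℕ → ℝ)
    (μ : Fin n → ℝ) : Store where
  nat x := if x = 0 then n else if x = 1 then m else if x = 2 then K else 0
  real _ := 0
  natArr A i :=
    if A = 0 then
      if h : i / n < m ∧ i % n < n then (V ⟨i / n, h.1⟩ ⟨i % n, h.2⟩ : ℕ) else 0
    else 0
  realArr A i :=
    if A = 0 then (if 2 ≤ i ∧ i ≤ n then β i else 0)
    else if A = 1 then (if h : i < n then μ ⟨i, h⟩ else 0)
    else 0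

/-- The memory `s` holds the output `ω`: cell `p` of the natural array `1` holds the candidate in
position `p` of `ω`. -/
def HoldsOutput {n : ℕ} (s : Store) (ω : Equiv.Perm (Fin n)) : Prop :=
  ∀ p : Fin n, s.natArr 1 p = (ω p : ℕ)

/-- On the input `K, V, β, μ` the program `P` halts after exactly `t` steps and returns a ranking
that is a possible output of Algorithm MyopicTop on this input. -/
def RunsMyopicTop {n m : ℕ} (P : Program) (K : ℕ) (V : Fin m → Equiv.Perm (Fin n)) (β : ℕ → ℝ)
    (μ : Fin n → ℝ) (t : ℕ) : Prop :=
  ∃ (s : Store) (ω : Equiv.Perm (Fin n)),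
    Exec P (inputStore K V β μ) s t ∧ HoldsOutput s ω ∧ RankAgg.IsMyopicTopOutput K V β μ ω

/-- `P` implements Algorithm MyopicTop on all of its inputs. -/
def ImplementsMyopicTop (P : Program) : Prop :=
  ∀ (n m K : ℕ) (V : Fin m → Equiv.Perm (Fin n)) (β : ℕ → ℝ) (μ : Fin n → ℝ),
    2 ≤ n → 1 ≤ m → 1 ≤ K → (∀ k, 2 ≤ k → k ≤ n → 0 ≤ β k) → (∀ i, 0 ≤ μ i) →
      ∃ t : ℕ, RunsMyopicTop P K V β μ t

end

end RealRAM

/-!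
The distance splits into one term per position, where the term at a position depends only on the
candidate placed there and on the set of candidates below it. A ranking can hence be compared with
an optimal one, one initial segment at a time.

While `Q` is the set of unplaced candidates and `c ∈ Q` is preferred to all of `Q` by more than
half of the voters, moving `c` up to the first free position, by adjacent swaps, does not increase
the distance: a swap of `c` with its upper neighbour `a` changes the best element only in menus
inside `Q`, from `a` to `c`, and there `c` is best for a majority. So some ranking that starts
with the candidates placed by the loop is at least as good as any given one.

When no majority candidate is left, the best element of `Q` in any ranking differs from that of at
least half of the voters, and each of these pays at least `2 u` for every menu inside `Q` that
contains both elements. The algorithm optimises the next `K` positions, and the positions behind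
them differ by at most `2 U` per voter and per menu inside the `|Q| - K` remaining candidates. The
quotient of these two menu weights is at most `h(K)`, so the relative error is at most `2 U h(K) /
u ≤ ε / 6`.

The program enumerates the `n ^ K` sequences of `K` digits in base `n`. The digits of a number say
with which positions the positions `i, …, i + K - 1` are exchanged in turn, and every choice of
the candidates in these positions arises in this way. With tables of the positions of the
candidates and of `f_β`, which Pascal's rule computes without division, a ranking is evaluated in
`O(n m K)` steps.
-/

namespace RankAgg

/-! ## Sums over menus -/

section FinsetSums

variable {α M : Type*} [DecidableEq α]

theorem sum_symmDiff [AddCommGroup M] (A B : Finset α) (f : α → M) :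
    ∑ x ∈ symmDiff A B, f x = ∑ x ∈ A, f x + ∑ x ∈ B, f x - 2 • ∑ x ∈ A ∩ B, f x := by
  have hA := Finset.sum_sdiff (f := f) (Finset.inter_subset_left : A ∩ B ⊆ A)
  have hB := Finset.sum_sdiff (f := f) (Finset.inter_subset_right : A ∩ B ⊆ B)
  rw [Finset.sdiff_inter_self_left] at hA
  rw [Finset.sdiff_inter_self_right] at hB
  rw [symmDiff, Finset.sup_eq_union, Finset.sum_union disjoint_sdiff_sdiff, ← hA, ← hB]
  abel

theorem sum_symmDiff_singleton [AddCommGroup M] (a b : α) (f : α → M) :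
    ∑ x ∈ symmDiff {a} {b}, f x = if a = b then 0 else f a + f b := by
  split_ifs with h
  · simp [h]
  · simp [sum_symmDiff, h]

theorem sum_Icc_apply_card [AddCommMonoid M] {D E : Finset α} (h : D ⊆ E) (g : ℕ → M) :
    ∑ S ∈ Finset.Icc D E, g S.card =
      ∑ k ∈ Finset.range (E.card - D.card + 1), (E.card - D.card).choose k • g (D.card + k) := by
  have hdisj : ∀ T ∈ (E \ D).powerset, Disjoint D T := fun T hT =>
    Finset.disjoint_of_subset_right (Finset.mem_powerset.1 hT) Finset.disjoint_sdiff
  rw [Finset.Icc_eq_image_powerset h, Finset.sum_image fun T hT T' hT' hTT' => by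
    rw [← Finset.union_sdiff_cancel_left (hdisj T hT), hTT',
      Finset.union_sdiff_cancel_left (hdisj T' hT')]]
  rw [Finset.sum_congr rfl fun T hT => by rw [Finset.card_union_of_disjoint (hdisj T hT)],
    Finset.sum_powerset_apply_card fun k => g (D.card + k), Finset.card_sdiff_of_subset h]

end FinsetSums

variable {n m : ℕ} {β : ℕ → ℝ} {μ : Fin n → ℝ} {σ σ' π ω : Equiv.Perm (Fin n)}
  {S Q : Finset (Fin n)} {a c x y : Fin n} {V : Fin m → Equiv.Perm (Fin n)} {l : List (Fin n)}

theorem mem_below : y ∈ below σ x ↔ Prefers σ x y := by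
  simp [below]

theorem notMem_below_self (σ : Equiv.Perm (Fin n)) (x : Fin n) : x ∉ below σ x := by
  simp [mem_below, Prefers]

theorem card_below (σ : Equiv.Perm (Fin n)) (p : Fin n) :
    (below σ (σ p)).card = n - (p + 1) := by
  have : below σ (σ p) = (Finset.Ioi p).map σ.toEmbedding := by
    ext y
    simp [mem_below, Prefers, Finset.mem_map_equiv]
  rw [this, Finset.card_map, Fin.card_Ioi]
  omega

theorem mem_best : x ∈ best S σ ↔ x ∈ S ∧ ∀ y ∈ S, y ≠ x → Prefers σ x y := by
  rw [best, Finset.mem_filter]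

theorem mem_best_iff_mem_Icc :
    x ∈ best S σ ↔ S ∈ Finset.Icc {x} (insert x (below σ x)) := by
  rw [mem_best, Finset.mem_Icc, Finset.singleton_subset_iff]
  simp only [Finset.subset_iff, Finset.mem_insert, mem_below, ne_eq, or_iff_not_imp_left]

theorem best_eq_singleton (hx : x ∈ best S σ) : best S σ = {x} := by
  refine Finset.eq_singleton_iff_unique_mem.2 ⟨hx, fun y hy => ?_⟩
  by_contra hne
  exact lt_asymm ((mem_best.1 hx).2 y (mem_best.1 hy).1 hne)
    ((mem_best.1 hy).2 x (mem_best.1 hx).1 (Ne.symm hne))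

theorem exists_mem_best (hS : S.Nonempty) (σ : Equiv.Perm (Fin n)) : ∃ x, x ∈ best S σ := by
  obtain ⟨x, hx, hmin⟩ := Finset.exists_min_image S (fun y => σ.symm y) hS
  exact ⟨x, mem_best.2 ⟨hx, fun y hy hne =>
    (hmin y hy).lt_of_ne (σ.symm.injective.ne hne.symm)⟩⟩

theorem mem_best_of_subset (hx : x ∈ best Q σ) (hS : S ⊆ Q) (hxS : x ∈ S) : x ∈ best S σ :=
  mem_best.2 ⟨hxS, fun y hy => (mem_best.1 hx).2 y (hS hy)⟩

theorem topDist_nonneg (hβ : ∀ k, 2 ≤ k → 0 ≤ β k) (hμ : ∀ x, 0 ≤ μ x)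
    (σ π : Equiv.Perm (Fin n)) : 0 ≤ topDist β μ σ π :=
  Finset.sum_nonneg fun _ hS => mul_nonneg (hβ _ (Finset.mem_filter.1 hS).2)
    (Finset.sum_nonneg fun x _ => hμ x)

theorem profileDist_nonneg (hβ : ∀ k, 2 ≤ k → 0 ≤ β k) (hμ : ∀ x, 0 ≤ μ x)
    (σ : Equiv.Perm (Fin n)) (V : Fin m → Equiv.Perm (Fin n)) : 0 ≤ profileDist β μ σ V :=
  Finset.sum_nonneg fun j _ => topDist_nonneg hβ hμ σ (V j)

/-! ## The distance as a sum over positions -/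

theorem fBeta_nonneg (hβ : ∀ k, 2 ≤ k → 0 ≤ β k) (t : ℕ) : 0 ≤ fBeta n β t :=
  Finset.sum_nonneg fun k hk => mul_nonneg (hβ k (Finset.mem_Icc.1 hk).1) (Nat.cast_nonneg _)

theorem fBeta_mono (hβ : ∀ k, 2 ≤ k → 0 ≤ β k) : Monotone (fBeta n β) := fun _ _ hst =>
  Finset.sum_le_sum fun k hk => mul_le_mul_of_nonneg_left
    (Nat.cast_le.2 (Nat.choose_le_choose _ hst)) (hβ k (Finset.mem_Icc.1 hk).1)

theorem fBeta_eq_sum_range (n : ℕ) (β : ℕ → ℝ) (t : ℕ) :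
    fBeta n β t = ∑ k ∈ Finset.range n with 1 ≤ k, β (k + 1) * (t.choose k : ℝ) := by
  refine Finset.sum_nbij' (· - 1) (· + 1) ?_ ?_ ?_ ?_ ?_ <;>
    simp only [Finset.mem_filter, Finset.mem_range, Finset.mem_Icc] <;> intro k hk
  · omega
  · omega
  · omega
  · omega
  · rw [Nat.sub_add_cancel (by omega)]

theorem sum_Icc_insert_eq_fBeta (β : ℕ → ℝ) {B : Finset (Fin n)} (hx : x ∉ B) :
    ∑ S ∈ Finset.Icc {x} (insert x B) with 2 ≤ S.card, β S.card = fBeta n β B.card := by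
  have hcard : (insert x B).card = B.card + 1 := Finset.card_insert_of_notMem hx
  have hBn : B.card + 1 ≤ n := by
    simpa [hcard] using Finset.card_le_univ (insert x B)
  rw [Finset.sum_filter, sum_Icc_apply_card (by simp) fun k => if 2 ≤ k then β k else 0, hcard,
    Finset.card_singleton, Nat.add_sub_cancel, fBeta_eq_sum_range, Finset.sum_filter]
  refine Finset.sum_subset_zero_on_sdiff (Finset.range_subset_range.2 hBn) (fun k hk => ?_)
    fun k _ => ?_
  · rw [Nat.choose_eq_zero_of_lt (by simpa using (Finset.mem_sdiff.1 hk).2)]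
    simp
  · rw [nsmul_eq_mul, mul_ite, mul_zero, mul_comm, add_comm 1 k]
    exact if_congr (by omega) rfl rfl

theorem sum_menus_inter (β : ℕ → ℝ) (μ : Fin n → ℝ) (σ π : Equiv.Perm (Fin n)) :
    ∑ S : Finset (Fin n) with 2 ≤ S.card, β S.card * ∑ x ∈ best S σ ∩ best S π, μ x
      = ∑ x, fBeta n β (below σ x ∩ below π x).card * μ x := by
  have hmem (S : Finset (Fin n)) (x : Fin n) : x ∈ best S σ ∩ best S π ↔
      S ∈ Finset.Icc {x} (insert x (below σ x ∩ below π x)) := by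
    rw [Finset.insert_inter_distrib, Finset.mem_inter, mem_best_iff_mem_Icc, mem_best_iff_mem_Icc]
    simp only [Finset.mem_Icc, Finset.subset_inter_iff]
    tauto
  simp only [Finset.mul_sum]
  rw [Finset.sum_comm' (t' := Finset.univ)
    (s' := fun x => {S ∈ Finset.Icc {x} (insert x (below σ x ∩ below π x)) | 2 ≤ S.card})
    (by simp [hmem, and_comm])]
  refine Finset.sum_congr rfl fun x _ => ?_
  rw [← Finset.sum_mul, sum_Icc_insert_eq_fBeta β
    fun h => notMem_below_self σ x (Finset.mem_inter.1 h).1]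

theorem sum_menus (β : ℕ → ℝ) (μ : Fin n → ℝ) (σ : Equiv.Perm (Fin n)) :
    ∑ S : Finset (Fin n) with 2 ≤ S.card, β S.card * ∑ x ∈ best S σ, μ x
      = ∑ p : Fin n, fBeta n β (n - (p + 1)) * μ (σ p) := by
  have h := sum_menus_inter β μ σ σ
  simp only [Finset.inter_self] at h
  rw [h, ← Equiv.sum_comp σ]
  simp_rw [card_below]

/-- The contribution of the position `p`, numbered from `0`, to the distance of `σ` and `π`: the
summand `i = p + 1` of `d(σ, π; b, t)`. -/
noncomputable def posTerm (β : ℕ → ℝ) (μ : Fin n → ℝ) (σ π : Equiv.Perm (Fin n)) (p : Fin n) : ℝ :=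
  fBeta n β (n - ((p : ℕ) + 1)) * (μ (σ p) + μ (π p))
    - 2 * fBeta n β (below σ (σ p) ∩ below π (σ p)).card * μ (σ p)

theorem truncDist_eq_sum_posTerm (β : ℕ → ℝ) (μ : Fin n → ℝ) (σ π : Equiv.Perm (Fin n))
    (b t : ℕ) :
    truncDist β μ σ π b t =
      ∑ p ∈ Finset.univ.filter fun p : Fin n => b ≤ (p : ℕ) + 1 ∧ (p : ℕ) + 1 ≤ t,
        posTerm β μ σ π p := rfl

theorem topDist_eq_truncDist (β : ℕ → ℝ) (μ : Fin n → ℝ) (σ π : Equiv.Perm (Fin n)) :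
    topDist β μ σ π = truncDist β μ σ π 1 n := by
  have hall : ∀ p : Fin n, 1 ≤ (p : ℕ) + 1 ∧ (p : ℕ) + 1 ≤ n := fun p => by omega
  rw [truncDist_eq_sum_posTerm, Finset.filter_true_of_mem fun p _ => hall p]
  simp only [topDist, sum_symmDiff, posTerm, nsmul_eq_mul, Nat.cast_ofNat, mul_sub, mul_add,
    Finset.sum_add_distrib, Finset.sum_sub_distrib, sum_menus]
  simp_rw [mul_left_comm _ (2 : ℝ), ← Finset.mul_sum, mul_assoc (2 : ℝ), ← Finset.mul_sum]
  rw [sum_menus_inter,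
    ← Equiv.sum_comp σ fun x => fBeta n β (below σ x ∩ below π x).card * μ x]

theorem truncDist_add_truncDist (β : ℕ → ℝ) (μ : Fin n → ℝ) (σ π : Equiv.Perm (Fin n))
    {b s t : ℕ} (hbs : b ≤ s + 1) (hst : s ≤ t) :
    truncDist β μ σ π b s + truncDist β μ σ π (s + 1) t = truncDist β μ σ π b t := by
  simp only [truncDist_eq_sum_posTerm, Finset.sum_filter, ← Finset.sum_add_distrib]
  refine Finset.sum_congr rfl fun p _ => ?_
  split_ifs <;> first | omega | simp

theorem profileTruncDist_add_profileTruncDist (β : ℕ → ℝ) (μ : Fin n → ℝ)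
    (σ : Equiv.Perm (Fin n)) (V : Fin m → Equiv.Perm (Fin n)) {b s t : ℕ} (hbs : b ≤ s + 1)
    (hst : s ≤ t) :
    profileTruncDist β μ σ V b s + profileTruncDist β μ σ V (s + 1) t =
      profileTruncDist β μ σ V b t := by
  simp only [profileTruncDist, ← Finset.sum_add_distrib, truncDist_add_truncDist β μ σ _ hbs hst]

theorem profileDist_eq_profileTruncDist (β : ℕ → ℝ) (μ : Fin n → ℝ) (σ : Equiv.Perm (Fin n))
    (V : Fin m → Equiv.Perm (Fin n)) :
    profileDist β μ σ V = profileTruncDist β μ σ V 1 n := by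
  simp only [profileDist, profileTruncDist, topDist_eq_truncDist]

theorem profileTruncDist_succ_self (β : ℕ → ℝ) (μ : Fin n → ℝ) (σ : Equiv.Perm (Fin n))
    (V : Fin m → Equiv.Perm (Fin n)) (t : ℕ) : profileTruncDist β μ σ V (t + 1) t = 0 :=
  Finset.sum_eq_zero fun j _ => by
    rw [truncDist_eq_sum_posTerm, Finset.filter_false_of_mem fun p _ => by omega,
      Finset.sum_empty]

theorem profileTruncDist_succ (β : ℕ → ℝ) (μ : Fin n → ℝ) (σ : Equiv.Perm (Fin n))
    (V : Fin m → Equiv.Perm (Fin n)) {b : ℕ} {p : Fin n} (hbp : b ≤ p) :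
    profileTruncDist β μ σ V (b + 1) (p + 1) =
      profileTruncDist β μ σ V (b + 1) p + ∑ j, posTerm β μ σ (V j) p := by
  have hsingle : (Finset.univ.filter fun q : Fin n => (p : ℕ) + 1 ≤ q + 1 ∧ (q : ℕ) + 1 ≤ p + 1) =
      {p} := by
    ext q
    grind
  rw [← profileTruncDist_add_profileTruncDist β μ σ V (Nat.succ_le_succ hbp) (Nat.le_succ p)]
  simp only [profileTruncDist, truncDist_eq_sum_posTerm _ _ _ _ (↑p + 1), hsingle,
    Finset.sum_singleton]

/-- The rankings `σ` and `σ'` agree on the first `e` positions. -/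
def AgreeBelow (e : ℕ) (σ σ' : Equiv.Perm (Fin n)) : Prop :=
  ∀ p : Fin n, (p : ℕ) < e → σ p = σ' p

theorem AgreeBelow.symm {e : ℕ} (h : AgreeBelow e σ σ') : AgreeBelow e σ' σ :=
  fun p hp => (h p hp).symm

theorem AgreeBelow.below_subset {e : ℕ} (h : AgreeBelow e σ σ') {p : Fin n} (hp : (p : ℕ) < e) :
    below σ (σ p) ⊆ below σ' (σ' p) := by
  intro y hy
  simp only [mem_below, Prefers, Equiv.symm_apply_apply] at hy ⊢
  by_contra! hle
  have hσ := h (σ'.symm y) (lt_of_le_of_lt (Fin.le_def.1 hle) hp)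
  rw [Equiv.apply_symm_apply, ← Equiv.eq_symm_apply] at hσ
  exact hle.not_gt (hσ ▸ hy)

theorem AgreeBelow.posTerm_eq {e : ℕ} (h : AgreeBelow e σ σ') (β : ℕ → ℝ) (μ : Fin n → ℝ)
    (π : Equiv.Perm (Fin n)) {p : Fin n} (hp : (p : ℕ) < e) :
    posTerm β μ σ π p = posTerm β μ σ' π p := by
  rw [posTerm, posTerm, (h.below_subset hp).antisymm (h.symm.below_subset hp), h p hp]

theorem AgreeBelow.truncDist_eq {b e : ℕ} (h : AgreeBelow e σ σ') (β : ℕ → ℝ) (μ : Fin n → ℝ)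
    (π : Equiv.Perm (Fin n)) : truncDist β μ σ π b e = truncDist β μ σ' π b e :=
  Finset.sum_congr rfl fun _ hp => h.posTerm_eq β μ π (Finset.mem_filter.1 hp).2.2

theorem AgreeBelow.profileTruncDist_eq {b e : ℕ} (h : AgreeBelow e σ σ') (β : ℕ → ℝ)
    (μ : Fin n → ℝ) (V : Fin m → Equiv.Perm (Fin n)) :
    profileTruncDist β μ σ V b e = profileTruncDist β μ σ' V b e :=
  Finset.sum_congr rfl fun j _ => h.truncDist_eq β μ (V j)

theorem StartsWith.agreeBelow (h : StartsWith σ l) (h' : StartsWith σ' l) :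
    AgreeBelow l.length σ σ' :=
  fun p hp => (h p hp).trans (h' p hp).symm

/-! ## The truncation error -/

/-- The total weight of the menus of at least two elements inside a set of `t` candidates: the
numerator of the quotient in `h(K)` with `t - K` for `t`. -/
noncomputable def menuWeight (β : ℕ → ℝ) (t : ℕ) : ℝ :=
  ∑ j ∈ Finset.Icc 2 t, β j * (t.choose j : ℝ)

theorem sum_range_fBeta {N : ℕ} (hN : N ≤ n) (β : ℕ → ℝ) :
    ∑ s ∈ Finset.range N, fBeta n β s = menuWeight β N := by
  have hpascal (N : ℕ) : ∑ s ∈ Finset.range N, fBeta n β s =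
      ∑ k ∈ Finset.Icc 2 n, β k * (N.choose k : ℝ) := by
    induction N with
    | zero =>
      refine (Finset.sum_eq_zero fun k hk => ?_).symm
      rw [Nat.choose_eq_zero_of_lt (by have := (Finset.mem_Icc.1 hk).1; omega)]
      simp
    | succ N ih =>
      rw [Finset.sum_range_succ, ih, fBeta, ← Finset.sum_add_distrib]
      refine Finset.sum_congr rfl fun k hk => ?_
      obtain ⟨k, rfl⟩ : ∃ k', k = k' + 1 := ⟨k - 1, by have := (Finset.mem_Icc.1 hk).1; omega⟩
      rw [Nat.choose_succ_succ, Nat.add_sub_cancel]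
      push_cast
      ring
  rw [hpascal, menuWeight]
  refine (Finset.sum_subset (Finset.Icc_subset_Icc_right hN) fun k hk hkN => ?_).symm
  simp only [Finset.mem_Icc] at hk hkN
  rw [Nat.choose_eq_zero_of_lt (by omega), Nat.cast_zero, mul_zero]

theorem sum_fBeta_tail (n : ℕ) (β : ℕ → ℝ) (e : ℕ) :
    ∑ p ∈ Finset.univ.filter fun p : Fin n => e + 1 ≤ (p : ℕ) + 1 ∧ (p : ℕ) + 1 ≤ n,
      fBeta n β (n - ((p : ℕ) + 1)) = menuWeight β (n - e) := by
  rw [← sum_range_fBeta (Nat.sub_le n e)]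
  refine Finset.sum_bij (fun p _ => n - ((p : ℕ) + 1)) (fun p hp => ?_) (fun p _ p' _ h => ?_)
    (fun s hs => ?_) fun _ _ => rfl
  · simp only [Finset.mem_filter] at hp
    simp only [Finset.mem_range]
    omega
  · exact Fin.ext (by omega)
  · have hs' := Finset.mem_range.1 hs
    refine ⟨⟨n - (s + 1), by omega⟩, ?_, by dsimp only; omega⟩
    simp only [Finset.mem_filter, Finset.mem_univ, true_and]
    omega

theorem posTerm_sub_posTerm_le (hβ : ∀ k, 2 ≤ k → 0 ≤ β k) {U : ℝ} (hμ : ∀ x, 0 ≤ μ x)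
    (hU : ∀ x, μ x ≤ U) (σ σ' π : Equiv.Perm (Fin n)) (p : Fin n) :
    posTerm β μ σ π p - posTerm β μ σ' π p ≤ 2 * U * fBeta n β (n - ((p : ℕ) + 1)) := by
  set f := fBeta n β (n - ((p : ℕ) + 1))
  have hf : 0 ≤ f := fBeta_nonneg hβ _
  have hσ : 0 ≤ fBeta n β (below σ (σ p) ∩ below π (σ p)).card * μ (σ p) :=
    mul_nonneg (fBeta_nonneg hβ _) (hμ _)
  have hσ' : fBeta n β (below σ' (σ' p) ∩ below π (σ' p)).card * μ (σ' p) ≤ f * μ (σ' p) := by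
    refine mul_le_mul_of_nonneg_right (fBeta_mono hβ ?_) (hμ _)
    rw [← card_below σ' p]
    exact Finset.card_le_card Finset.inter_subset_left
  have hfU : f * μ (σ p) ≤ f * U ∧ f * μ (σ' p) ≤ f * U :=
    ⟨mul_le_mul_of_nonneg_left (hU _) hf, mul_le_mul_of_nonneg_left (hU _) hf⟩
  simp only [posTerm]
  linarith

theorem profileTruncDist_tail_sub_le (hβ : ∀ k, 2 ≤ k → 0 ≤ β k) {U : ℝ} (hμ : ∀ x, 0 ≤ μ x)
    (hU : ∀ x, μ x ≤ U) (σ σ' : Equiv.Perm (Fin n)) (V : Fin m → Equiv.Perm (Fin n)) (e : ℕ) :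
    profileTruncDist β μ σ V (e + 1) n - profileTruncDist β μ σ' V (e + 1) n ≤
      m * (2 * U * menuWeight β (n - e)) := by
  have hvoter (j : Fin m) : truncDist β μ σ (V j) (e + 1) n - truncDist β μ σ' (V j) (e + 1) n ≤
      2 * U * menuWeight β (n - e) := by
    rw [truncDist_eq_sum_posTerm, truncDist_eq_sum_posTerm, ← Finset.sum_sub_distrib,
      ← sum_fBeta_tail, Finset.mul_sum]
    exact Finset.sum_le_sum fun p _ => posTerm_sub_posTerm_le hβ hμ hU σ σ' (V j) p
  rw [profileTruncDist, profileTruncDist, ← Finset.sum_sub_distrib]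
  simpa using Finset.sum_le_sum fun j (_ : j ∈ Finset.univ) => hvoter j

/-! ## Majority candidates come first -/

theorem isMajority_iff :
    IsMajority V Q c ↔ m < 2 * (Finset.univ.filter fun j => c ∈ best Q (V j)).card := by
  have hcast (k : ℕ) : (m : ℝ) / 2 < k ↔ m < 2 * k := by
    rw [div_lt_iff₀ two_pos, mul_comm]
    exact_mod_cast Iff.rfl
  have hbest (hc : c ∈ Q) (j : Fin m) :
      (∀ a ∈ Q.erase c, Prefers (V j) c a) ↔ c ∈ best Q (V j) := by
    simp only [mem_best, hc, true_and, Finset.mem_erase]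
    exact ⟨fun h y hy hne => h y ⟨hne, hy⟩, fun h y hy => h y hy.2 hy.1⟩
  rw [IsMajority, hcast]
  refine ⟨fun ⟨hc, hlt⟩ => by simpa only [hbest hc] using hlt, fun hlt => ?_⟩
  obtain ⟨j, hj⟩ := Finset.card_pos.1 (by omega :
    0 < (Finset.univ.filter fun j => c ∈ best Q (V j)).card)
  have hc := (mem_best.1 (Finset.mem_filter.1 hj).2).1
  exact ⟨hc, by simpa only [hbest hc] using hlt⟩

/-- The disagreement of the voters with the choice `A` from the menu `S`. -/
noncomputable def menuCost (μ : Fin n → ℝ) (V : Fin m → Equiv.Perm (Fin n))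
    (S A : Finset (Fin n)) : ℝ :=
  ∑ j, ∑ x ∈ symmDiff A (best S (V j)), μ x

theorem profileDist_eq_sum_menuCost (β : ℕ → ℝ) (μ : Fin n → ℝ) (σ : Equiv.Perm (Fin n))
    (V : Fin m → Equiv.Perm (Fin n)) :
    profileDist β μ σ V =
      ∑ S : Finset (Fin n) with 2 ≤ S.card, β S.card * menuCost μ V S (best S σ) := by
  simp only [profileDist, topDist, menuCost, Finset.mul_sum]
  rw [Finset.sum_comm]

theorem IsMajority.menuCost_le (hμ : ∀ x, 0 ≤ μ x) (hc : IsMajority V Q c) (hS : S ⊆ Q)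
    (hcS : c ∈ S) (a : Fin n) : menuCost μ V S {c} ≤ menuCost μ V S {a} := by
  obtain rfl | hac := eq_or_ne a c
  · exact le_rfl
  set w := μ a + μ c
  have hw : 0 ≤ w := add_nonneg (hμ a) (hμ c)
  have hvoter (j : Fin m) :
      ∑ x ∈ symmDiff {c} (best S (V j)), μ x - ∑ x ∈ symmDiff {a} (best S (V j)), μ x ≤
        w - if c ∈ best Q (V j) then 2 * w else 0 := by
    obtain ⟨v, hv⟩ := exists_mem_best ⟨c, hcS⟩ (V j)
    have hvc : c ∈ best Q (V j) → c = v := fun h => by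
      simpa [best_eq_singleton hv] using mem_best_of_subset h hS hcS
    rw [best_eq_singleton hv, sum_symmDiff_singleton, sum_symmDiff_singleton]
    split_ifs with hcv hav hcj hcj hav hcj hcj <;> grind
  rw [← sub_nonpos, menuCost, menuCost, ← Finset.sum_sub_distrib]
  refine (Finset.sum_le_sum fun j _ => hvoter j).trans ?_
  have hmaj : (m : ℝ) ≤ 2 * (Finset.univ.filter fun j => c ∈ best Q (V j)).card := by
    exact_mod_cast (isMajority_iff.1 hc).le
  rw [Finset.sum_sub_distrib, ← Finset.sum_filter, Finset.sum_const, Finset.sum_const,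
    Finset.card_univ, Fintype.card_fin, nsmul_eq_mul, nsmul_eq_mul]
  nlinarith

theorem LoopReaches.card_add_length (h : LoopReaches V l Q) : Q.card + l.length = n := by
  induction h with
  | start => simp
  | step _ hc ih =>
    rw [Finset.card_erase_of_mem hc.1, List.length_append, List.length_singleton]
    have := Finset.card_pos.2 ⟨_, hc.1⟩
    omega

theorem startsWith_append_singleton_iff (hl : l.length < n) :
    StartsWith ω (l ++ [c]) ↔ StartsWith ω l ∧ (ω.symm c : ℕ) = l.length := by
  refine ⟨fun h => ⟨fun p hp => ?_, ?_⟩, fun ⟨h, hc⟩ p hp => ?_⟩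
  · have := h p (by rw [List.length_append]; omega)
    rwa [List.getElem_append_left hp] at this
  · have := h ⟨l.length, hl⟩ (by simp)
    rw [List.getElem_concat_length rfl, ← Equiv.eq_symm_apply] at this
    rw [← this]
  · rw [List.length_append, List.length_singleton] at hp
    obtain hp | hp := Nat.lt_succ_iff_lt_or_eq.1 hp
    · rw [List.getElem_append_left hp, h p hp]
    · rw [List.getElem_concat_length hp, ← Equiv.eq_symm_apply]
      exact Fin.ext (hp.trans hc.symm)

theorem LoopReaches.mem_iff (h : LoopReaches V l Q) (hω : StartsWith ω l) (x : Fin n) :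
    x ∈ Q ↔ l.length ≤ ω.symm x := by
  induction h with
  | start => simp
  | @step l Q c hl hc ih =>
    have hlt : l.length < n := by
      have := hl.card_add_length
      have := Finset.card_pos.2 ⟨_, hc.1⟩
      omega
    obtain ⟨hωl, hωc⟩ := (startsWith_append_singleton_iff hlt).1 hω
    have hxc : x ≠ c ↔ (ω.symm x : ℕ) ≠ l.length := by
      rw [← hωc, Ne, Ne, ← Fin.ext_iff, EmbeddingLike.apply_eq_iff_eq]
    rw [Finset.mem_erase, ih hωl, hxc, List.length_append, List.length_singleton]
    omega

theorem swap_lt_swap_iff {p q i j : Fin n} (hpq : (q : ℕ) = p + 1) (h : ¬ (i = p ∧ j = q))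
    (h' : ¬ (i = q ∧ j = p)) : Equiv.swap p q i < Equiv.swap p q j ↔ i < j := by
  simp only [Equiv.swap_apply_def, Fin.ext_iff, Fin.lt_def] at *
  split_ifs <;> omega

theorem symm_mul_swap_apply (ω : Equiv.Perm (Fin n)) (p q x : Fin n) :
    (ω * Equiv.swap p q).symm x = Equiv.swap p q (ω.symm x) := by
  rw [← Equiv.Perm.inv_def, mul_inv_rev, Equiv.swap_inv]
  rfl

theorem prefers_mul_swap_iff {p q : Fin n} (hpq : (q : ℕ) = p + 1)
    (h : ¬ (x = ω p ∧ y = ω q)) (h' : ¬ (x = ω q ∧ y = ω p)) :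
    Prefers (ω * Equiv.swap p q) x y ↔ Prefers ω x y := by
  rw [Prefers, Prefers, symm_mul_swap_apply, symm_mul_swap_apply, swap_lt_swap_iff hpq] <;>
    simpa only [Equiv.symm_apply_eq]

theorem best_mul_swap {p q : Fin n} (hpq : (q : ℕ) = p + 1) (hS : S.Nonempty) :
    best S (ω * Equiv.swap p q) = best S ω ∨
      (best S (ω * Equiv.swap p q) = {ω q} ∧ ω q ∈ S ∧ ∀ y ∈ S, p ≤ ω.symm y) := by
  obtain ⟨t, ht⟩ := exists_mem_best hS ω
  obtain ⟨htS, hbest⟩ := mem_best.1 ht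
  by_cases htp : t = ω p ∧ ω q ∈ S
  · obtain ⟨rfl, hqS⟩ := htp
    refine Or.inr ⟨best_eq_singleton (mem_best.2 ⟨hqS, fun y hy hne => ?_⟩), hqS, fun y hy => ?_⟩
    · by_cases hyp : y = ω p
      · rw [hyp, Prefers, symm_mul_swap_apply, symm_mul_swap_apply]
        simp [Fin.lt_def, hpq]
      · have hlt := hbest y hy hyp
        have hyq : ω.symm y ≠ q := fun h => hne (by rw [← h, Equiv.apply_symm_apply])
        rw [prefers_mul_swap_iff hpq (by simp [hne]) (by simp [hyp])]
        simp only [Prefers, Equiv.symm_apply_apply, Fin.lt_def, ne_eq, Fin.ext_iff] at hlt hyq ⊢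
        omega
    · by_cases hyp : y = ω p
      · simp [hyp]
      · simpa [Prefers] using (hbest y hy hyp).le
  · left
    rw [best_eq_singleton ht]
    refine best_eq_singleton (mem_best.2 ⟨htS, fun y hy hne => ?_⟩)
    have hlt := hbest y hy hne
    refine (prefers_mul_swap_iff hpq (fun h => htp ⟨h.1, h.2 ▸ hy⟩) fun h => ?_).2 hlt
    simp only [h.1, h.2, Prefers, Equiv.symm_apply_apply, Fin.lt_def] at hlt
    omega

theorem profileDist_mul_swap_le (hβ : ∀ k, 2 ≤ k → 0 ≤ β k) (hμ : ∀ x, 0 ≤ μ x) {p q : Fin n}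
    (hpq : (q : ℕ) = p + 1) (hQ : ∀ y, p ≤ ω.symm y → y ∈ Q) (hq : IsMajority V Q (ω q)) :
    profileDist β μ (ω * Equiv.swap p q) V ≤ profileDist β μ ω V := by
  rw [profileDist_eq_sum_menuCost, profileDist_eq_sum_menuCost]
  refine Finset.sum_le_sum fun S hS => ?_
  have hS2 := (Finset.mem_filter.1 hS).2
  have hne : S.Nonempty := Finset.card_pos.1 (by omega)
  refine mul_le_mul_of_nonneg_left ?_ (hβ _ hS2)
  obtain h | ⟨h, hqS, hSp⟩ := best_mul_swap (ω := ω) hpq hne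
  · rw [h]
  · obtain ⟨a, ha⟩ := exists_mem_best hne ω
    rw [h, best_eq_singleton ha]
    exact hq.menuCost_le hμ (fun y hy => hQ y (hSp y hy)) hqS a

theorem StartsWith.mul_swap (hω : StartsWith ω l) {p q : Fin n} (hp : l.length ≤ p)
    (hq : l.length ≤ q) : StartsWith (ω * Equiv.swap p q) l := fun r hr => by
  rw [Equiv.Perm.mul_apply, Equiv.swap_apply_of_ne_of_ne (by rintro rfl; omega)
    (by rintro rfl; omega)]
  exact hω r hr

/-- The majority candidate moves up by adjacent swaps, none of which increases the distance. -/
theorem LoopReaches.exists_startsWith_append (hβ : ∀ k, 2 ≤ k → 0 ≤ β k) (hμ : ∀ x, 0 ≤ μ x)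
    (hl : LoopReaches V l Q) (hc : IsMajority V Q c) (hω : StartsWith ω l) :
    ∃ ω', StartsWith ω' (l ++ [c]) ∧ profileDist β μ ω' V ≤ profileDist β μ ω V := by
  obtain ⟨d, hd⟩ := Nat.exists_eq_add_of_le ((hl.mem_iff hω c).1 hc.1)
  induction d generalizing ω with
  | zero => exact ⟨ω, (startsWith_append_singleton_iff (by omega)).2 ⟨hω, hd⟩, le_rfl⟩
  | succ d ih =>
    set q := ω.symm c with hq
    have hcq : ω q = c := Equiv.apply_symm_apply ω c
    set p : Fin n := ⟨l.length + d, by omega⟩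
    have hp : (p : ℕ) = l.length + d := rfl
    obtain ⟨ω', hω', hle⟩ := ih (hω.mul_swap (p := p) (q := q) (by omega) (by omega))
      (by rw [symm_mul_swap_apply, ← hq, Equiv.swap_apply_right])
    refine ⟨ω', hω', hle.trans (profileDist_mul_swap_le hβ hμ (Q := Q) (by omega) ?_ (hcq ▸ hc))⟩
    exact fun y hy => (hl.mem_iff hω y).2 (by have := Fin.le_def.1 hy; omega)

theorem LoopReaches.exists_startsWith_profileDist_le (hβ : ∀ k, 2 ≤ k → 0 ≤ β k)
    (hμ : ∀ x, 0 ≤ μ x) (h : LoopReaches V l Q) (σ : Equiv.Perm (Fin n)) :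
    ∃ ω, StartsWith ω l ∧ profileDist β μ ω V ≤ profileDist β μ σ V := by
  induction h with
  | start => exact ⟨σ, fun p hp => absurd hp (Nat.not_lt_zero _), le_rfl⟩
  | step hl hc ih =>
    obtain ⟨ω, hω, hle⟩ := ih
    obtain ⟨ω', hω', hle'⟩ := hl.exists_startsWith_append hβ hμ hc hω
    exact ⟨ω', hω', hle'.trans hle⟩

/-! ## The approximation guarantee -/

/-- The total weight of the menus inside a set of `t` candidates that contain two given ones: the
denominator of the quotient in `h(K)`. -/
noncomputable def pairWeight (β : ℕ → ℝ) (t : ℕ) : ℝ :=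
  ∑ j ∈ Finset.Icc 0 (t - 2), β (j + 2) * ((t - 2).choose j : ℝ)

theorem pairWeight_pos (hβ : ∀ k, 2 ≤ k → 0 ≤ β k) (hβ2 : 0 < β 2) (t : ℕ) :
    0 < pairWeight β t :=
  Finset.sum_pos' (fun _ _ => mul_nonneg (hβ _ (by omega)) (Nat.cast_nonneg _))
    ⟨0, by simp, by simpa using hβ2⟩

theorem pairWeight_nonneg (hβ : ∀ k, 2 ≤ k → 0 ≤ β k) (t : ℕ) : 0 ≤ pairWeight β t :=
  Finset.sum_nonneg fun _ _ => mul_nonneg (hβ _ (by omega)) (Nat.cast_nonneg _)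

theorem sum_Icc_pair_eq_pairWeight (β : ℕ → ℝ) (ha : a ∈ Q) (hc : c ∈ Q) (hac : a ≠ c) :
    ∑ S ∈ Finset.Icc {a, c} Q, β S.card = pairWeight β Q.card := by
  rw [sum_Icc_apply_card (by simp [Finset.insert_subset_iff, ha, hc]), Finset.card_pair hac,
    pairWeight, Nat.range_succ_eq_Icc_zero]
  exact Finset.sum_congr rfl fun k _ => by rw [nsmul_eq_mul, mul_comm, add_comm]

theorem mul_pairWeight_le_topDist (hβ : ∀ k, 2 ≤ k → 0 ≤ β k) (hμ : ∀ x, 0 ≤ μ x)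
    (ha : a ∈ best Q σ) (hc : c ∈ best Q π) (hac : a ≠ c) :
    (μ a + μ c) * pairWeight β Q.card ≤ topDist β μ σ π := by
  have hpair {S : Finset (Fin n)} (hS : S ∈ Finset.Icc {a, c} Q) : a ∈ S ∧ c ∈ S ∧ S ⊆ Q := by
    simpa [Finset.insert_subset_iff, and_assoc] using hS
  rw [← sum_Icc_pair_eq_pairWeight β (mem_best.1 ha).1 (mem_best.1 hc).1 hac, Finset.mul_sum,
    topDist]
  calc ∑ S ∈ Finset.Icc {a, c} Q, (μ a + μ c) * β S.card
      = ∑ S ∈ Finset.Icc {a, c} Q,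
          β S.card * ∑ x ∈ symmDiff (best S σ) (best S π), μ x := by
        refine Finset.sum_congr rfl fun S hS => ?_
        obtain ⟨haS, hcS, hSQ⟩ := hpair hS
        rw [best_eq_singleton (mem_best_of_subset ha hSQ haS),
          best_eq_singleton (mem_best_of_subset hc hSQ hcS), sum_symmDiff_singleton, if_neg hac,
          mul_comm]
    _ ≤ _ := by
        refine Finset.sum_le_sum_of_subset_of_nonneg (fun S hS => ?_) fun S hS _ =>
          mul_nonneg (hβ _ (Finset.mem_filter.1 hS).2) (Finset.sum_nonneg fun x _ => hμ x)
        obtain ⟨haS, hcS, -⟩ := hpair hS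
        exact Finset.mem_filter.2 ⟨Finset.mem_univ _, Finset.one_lt_card.2 ⟨a, haS, c, hcS, hac⟩⟩

theorem mul_pairWeight_le_profileDist (hβ : ∀ k, 2 ≤ k → 0 ≤ β k) {u : ℝ} (hu : 0 ≤ u)
    (hμ : ∀ x, u ≤ μ x) (hQ : Q.Nonempty) (hno : ¬ ∃ c, IsMajority V Q c)
    (σ : Equiv.Perm (Fin n)) : m * u * pairWeight β Q.card ≤ profileDist β μ σ V := by
  have hμ0 (x : Fin n) : 0 ≤ μ x := hu.trans (hμ x)
  have hD : 0 ≤ pairWeight β Q.card := pairWeight_nonneg hβ _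
  obtain ⟨c, hc⟩ := exists_mem_best hQ σ
  have hvoter (j : Fin m) :
      2 * u * pairWeight β Q.card -
        (if c ∈ best Q (V j) then 2 * u * pairWeight β Q.card else 0) ≤ topDist β μ σ (V j) := by
    split_ifs with hj
    · simpa using topDist_nonneg hβ hμ0 σ (V j)
    · obtain ⟨a, ha⟩ := exists_mem_best hQ (V j)
      have hca : c ≠ a := fun h => hj (h ▸ ha)
      rw [sub_zero]
      refine le_trans ?_ (mul_pairWeight_le_topDist hβ hμ0 hc ha hca)
      exact mul_le_mul_of_nonneg_right (by linarith [hμ a, hμ c]) hD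
  have hminority : 2 * ((Finset.univ.filter fun j => c ∈ best Q (V j)).card : ℝ) ≤ m := by
    exact_mod_cast not_lt.1 fun h => hno ⟨c, isMajority_iff.2 h⟩
  refine le_trans ?_ (Finset.sum_le_sum fun j _ => hvoter j)
  rw [Finset.sum_sub_distrib, ← Finset.sum_filter, Finset.sum_const, Finset.sum_const,
    Finset.card_univ, Fintype.card_fin, nsmul_eq_mul, nsmul_eq_mul]
  nlinarith [mul_nonneg hu hD]

theorem menuWeight_le_mul_pairWeight (hβ : ∀ k, 2 ≤ k → 0 ≤ β k) (hβ2 : 0 < β 2) {K : ℕ} {δ : ℝ}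
    (hδ : 0 ≤ δ) (hK : growthSup β K ≤ ENNReal.ofReal δ) {t : ℕ} (ht : max K 2 ≤ t) :
    menuWeight β (t - K) ≤ δ * pairWeight β t := by
  rw [← div_le_iff₀ (pairWeight_pos hβ hβ2 t), ← ENNReal.ofReal_le_ofReal_iff hδ]
  exact (le_iSup₂ (f := fun (t : ℕ) (_ : max K 2 ≤ t) =>
    ENNReal.ofReal (menuWeight β (t - K) / pairWeight β t)) t ht).trans hK

theorem depth_mem_depthSet (hlim : Tendsto (growthSup β) atTop (𝓝 0)) {x : ℝ} (hx : 0 < x) :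
    depth β x ∈ depthSet β (1 / x) := by
  have hδ : (0 : ℝ≥0∞) < ENNReal.ofReal (1 / x) := ENNReal.ofReal_pos.2 (one_div_pos.2 hx)
  obtain ⟨K, hK, hK1⟩ :=
    ((hlim.eventually (gt_mem_nhds hδ)).and (eventually_ge_atTop 1)).exists
  exact Nat.sInf_mem ⟨K, hK1, hK.le⟩

theorem truncation_error_le (hβ : ∀ k, 2 ≤ k → 0 ≤ β k) (hβ2 : 0 < β 2) {u U δ : ℝ} (hu : 0 < u)
    (hU : 0 ≤ U) (hδ : 0 ≤ δ) (hμ : ∀ x, u ≤ μ x) {K : ℕ}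
    (hK : growthSup β K ≤ ENNReal.ofReal δ) (hno : ¬ ∃ c, IsMajority V Q c)
    (σ : Equiv.Perm (Fin n)) :
    m * (2 * U * menuWeight β (Q.card - min K Q.card)) ≤
      2 * U * δ / u * profileDist β μ σ V := by
  have hdist : 0 ≤ profileDist β μ σ V :=
    profileDist_nonneg hβ (fun x => hu.le.trans (hμ x)) σ V
  by_cases hKQ : max K 2 ≤ Q.card
  · have hKQ' := menuWeight_le_mul_pairWeight hβ hβ2 hδ hK hKQ
    rw [min_eq_left (by omega)]
    calc m * (2 * U * menuWeight β (Q.card - K))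
        ≤ m * (2 * U * (δ * pairWeight β Q.card)) := by gcongr
      _ = 2 * U * δ / u * (m * u * pairWeight β Q.card) := by field_simp
      _ ≤ 2 * U * δ / u * profileDist β μ σ V := by
        gcongr
        exact mul_pairWeight_le_profileDist hβ hu.le hμ (Finset.card_pos.1 (by omega)) hno σ
  · rw [menuWeight, Finset.Icc_eq_empty (by omega), Finset.sum_empty, mul_zero, mul_zero]
    positivity

theorem IsMyopicTopOutput.profileDist_le (hβ : ∀ k, 2 ≤ k → 0 ≤ β k) (hβ2 : 0 < β 2)
    {u U δ : ℝ} (hu : 0 < u) (hδ : 0 ≤ δ) (hU : 0 ≤ U) (hμ : ∀ x, u ≤ μ x ∧ μ x ≤ U) {K : ℕ}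
    (hK : growthSup β K ≤ ENNReal.ofReal δ) (hσ : IsMyopicTopOutput K V β μ σ)
    (σ' : Equiv.Perm (Fin n)) :
    profileDist β μ σ V ≤ (1 + 2 * U * δ / u) * profileDist β μ σ' V := by
  obtain ⟨l, Q, hl, hno, hσl, hmin⟩ := hσ
  have hμ0 (x : Fin n) : 0 ≤ μ x := hu.le.trans (hμ x).1
  obtain ⟨ω, hω, hωσ'⟩ := hl.exists_startsWith_profileDist_le hβ hμ0 σ'
  have hcard := hl.card_add_length
  set e := l.length + min K Q.card
  have hsplit (ρ : Equiv.Perm (Fin n)) : profileDist β μ ρ V =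
      profileTruncDist β μ ρ V 1 l.length + profileTruncDist β μ ρ V (l.length + 1) e +
        profileTruncDist β μ ρ V (e + 1) n := by
    rw [profileTruncDist_add_profileTruncDist _ _ _ _ (by omega) (by omega),
      profileTruncDist_add_profileTruncDist _ _ _ _ (by omega) (by omega),
      profileDist_eq_profileTruncDist]
  have hinitial := (hσl.agreeBelow hω).profileTruncDist_eq (b := 1) β μ V
  have htail := profileTruncDist_tail_sub_le hβ hμ0 (fun x => (hμ x).2) σ ω V e
  rw [show n - e = Q.card - min K Q.card by omega] at htail
  have herror := truncation_error_le hβ hβ2 hu hU hδ (fun x => (hμ x).1) hK hno ω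
  have hσω : profileDist β μ σ V ≤ (1 + 2 * U * δ / u) * profileDist β μ ω V := by
    rw [one_add_mul]
    linarith [hsplit σ, hsplit ω, hmin ω hω]
  exact hσω.trans (by gcongr)

end RankAgg

namespace RealRAM

/-! ## Verification of programs -/

section Verification

variable {P P' : Program} {s s' s₁ s₂ s₃ : Store} {t T T' : ℕ} {Q Q' : Store → Prop}

/-- The operation writes the natural register `x`. -/
def Op.writesNat (x : ℕ) : Op → Bool
  | .natConst y _ | .natAdd y _ _ | .natSub y _ _ | .natLoad y _ _ => x == y
  | _ => false

/-- The operation writes the real register `x`. -/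
def Op.writesReal (x : ℕ) : Op → Bool
  | .realConst y _ | .realAdd y _ _ | .realSub y _ _ | .realMul y _ _ | .realLoad y _ _ => x == y
  | _ => false

/-- The operation writes the natural array `A`. -/
def Op.writesNatArr (A : ℕ) : Op → Bool
  | .natStore B _ _ => A == B
  | _ => false

/-- The operation writes the real array `A`. -/
def Op.writesRealArr (A : ℕ) : Op → Bool
  | .realStore B _ _ => A == B
  | _ => false

/-- Some operation in the text of the program satisfies `f`. -/
def Program.anyOp (f : Op → Bool) : Program → Bool
  | .op o => f o
  | .seq P Q => P.anyOp f || Q.anyOp f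
  | .ite _ P Q => P.anyOp f || Q.anyOp f
  | .loop _ P => P.anyOp f

/-- The memories `s` and `s'` agree on everything that `P` does not write. As this is decided by
the text of `P`, concrete instances of the side conditions hold by computation. -/
structure Frame (P : Program) (s s' : Store) : Prop where
  nat : ∀ x, P.anyOp (Op.writesNat x) = false → s'.nat x = s.nat x
  real : ∀ x, P.anyOp (Op.writesReal x) = false → s'.real x = s.real x
  natArr : ∀ A, P.anyOp (Op.writesNatArr A) = false → s'.natArr A = s.natArr A
  realArr : ∀ A, P.anyOp (Op.writesRealArr A) = false → s'.realArr A = s.realArr A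

theorem Frame.refl (P : Program) (s : Store) : Frame P s s :=
  ⟨fun _ _ => rfl, fun _ _ => rfl, fun _ _ => rfl, fun _ _ => rfl⟩

theorem Frame.trans (h : Frame P s₁ s₂) (h' : Frame P s₂ s₃) : Frame P s₁ s₃ :=
  ⟨fun x hx => (h'.nat x hx).trans (h.nat x hx), fun x hx => (h'.real x hx).trans (h.real x hx),
    fun A hA => (h'.natArr A hA).trans (h.natArr A hA),
    fun A hA => (h'.realArr A hA).trans (h.realArr A hA)⟩

theorem Frame.mono (hP : ∀ f : Op → Bool, P'.anyOp f = false → P.anyOp f = false)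
    (h : Frame P s s') : Frame P' s s' :=
  ⟨fun x hx => h.nat x (hP _ hx), fun x hx => h.real x (hP _ hx),
    fun A hA => h.natArr A (hP _ hA), fun A hA => h.realArr A (hP _ hA)⟩

theorem Frame.seq (h : Frame P s₁ s₂) (h' : Frame P' s₂ s₃) : Frame (.seq P P') s₁ s₃ :=
  (h.mono fun f hf => by simp_all only [Program.anyOp, Bool.or_eq_false_iff]).trans
    (h'.mono fun f hf => by simp_all only [Program.anyOp, Bool.or_eq_false_iff])

theorem Frame.loop {b : Test} (h : Frame P s s') : Frame (.loop b P) s s' :=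
  h.mono (P := P) fun _ hf => hf

theorem Frame.op (o : Op) (s : Store) : Frame (.op o) s (o.apply s) := by
  constructor <;> intro x hx <;> cases o <;>
    simp_all [Op.apply, Program.anyOp, Op.writesNat, Op.writesReal, Op.writesNatArr,
      Op.writesRealArr]

theorem Exec.frame (h : Exec P s s' t) : Frame P s s' := by
  induction h with
  | op o s => exact .op o s
  | seq _ _ ih ih' => exact ih.seq ih'
  | iteTrue _ _ ih | iteFalse _ _ ih =>
    exact ih.mono fun f hf => by simp_all only [Program.anyOp, Bool.or_eq_false_iff]
  | loopTrue _ _ _ ih ih' => exact ih.loop.trans ih'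
  | loopFalse _ => exact .refl _ _

/-- Started in the memory `s`, the program `P` halts after at most `T` steps in a memory that
satisfies `Q`. -/
def Run (P : Program) (s : Store) (T : ℕ) (Q : Store → Prop) : Prop :=
  ∃ s' t, Exec P s s' t ∧ t ≤ T ∧ Q s'

theorem Run.imp (h : Run P s T Q) (hQ : ∀ s', Frame P s s' → Q s' → Q' s') : Run P s T Q' := by
  obtain ⟨s', t, he, ht, hq⟩ := h
  exact ⟨s', t, he, ht, hQ s' he.frame hq⟩

theorem Run.le (h : Run P s T Q) (hT : T ≤ T') : Run P s T' Q := by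
  obtain ⟨s', t, he, ht, hq⟩ := h
  exact ⟨s', t, he, ht.trans hT, hq⟩

theorem Run.op {o : Op} (h : Q (o.apply s)) : Run (.op o) s 1 Q :=
  ⟨_, 1, .op o s, le_rfl, h⟩

theorem Run.seq (h : Run P s T Q) (h' : ∀ s', Frame P s s' → Q s' → Run P' s' T' Q') :
    Run (.seq P P') s (T + T') Q' := by
  obtain ⟨s₁, t₁, he, ht, hq⟩ := h
  obtain ⟨s₂, t₂, he', ht', hq'⟩ := h' s₁ he.frame hq
  exact ⟨s₂, t₁ + t₂, he.seq he', by omega, hq'⟩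

theorem Run.ite {b : Test} (h : b.Holds s → Run P s T Q) (h' : ¬ b.Holds s → Run P' s T Q) :
    Run (.ite b P P') s (T + 1) Q := by
  by_cases hb : b.Holds s
  · obtain ⟨s', t, he, ht, hq⟩ := h hb
    exact ⟨s', t + 1, .iteTrue hb he, by omega, hq⟩
  · obtain ⟨s', t, he, ht, hq⟩ := h' hb
    exact ⟨s', t + 1, .iteFalse hb he, by omega, hq⟩

theorem Run.ite_natLt {x y a b : ℕ} (hx : s.nat x = a) (hy : s.nat y = b)
    (h : a < b → Run P s T Q) (h' : b ≤ a → Run P' s T Q) :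
    Run (.ite (.natLt x y) P P') s (T + 1) Q := by
  subst hx hy
  exact Run.ite h fun hxy => h' (not_lt.1 hxy)

theorem Run.ite_realLt {x y : ℕ} {a b : ℝ} (hx : s.real x = a) (hy : s.real y = b)
    (h : a < b → Run P s T Q) (h' : b ≤ a → Run P' s T Q) :
    Run (.ite (.realLt x y) P P') s (T + 1) Q := by
  subst hx hy
  exact Run.ite h fun hxy => h' (not_lt.1 hxy)

/-- A natural-valued variant `v` that every round decreases bounds the number of rounds. -/
theorem Run.loop {b : Test} (I : ℕ → Store → Prop)
    (hstep : ∀ v s, I v s → b.Holds s → Run P s T fun s' => ∃ v' < v, I v' s')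
    (hexit : ∀ v s, I v s → ¬ b.Holds s → Q s) {v : ℕ} (hs : I v s) :
    Run (.loop b P) s (v * (T + 1) + 1) Q := by
  induction v using Nat.strong_induction_on generalizing s with
  | _ v ih =>
    by_cases hb : b.Holds s
    · obtain ⟨s₁, t₁, he, ht, v', hv', hs₁⟩ := hstep v s hs hb
      obtain ⟨s₂, t₂, he', ht', hq⟩ := ih v' hv' hs₁
      have hle : v' * (T + 1) + (T + 1) ≤ v * (T + 1) := by
        simpa only [Nat.succ_mul] using Nat.mul_le_mul_right (T + 1) hv'
      exact ⟨s₂, _, .loopTrue hb he he', by omega, hq⟩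
    · exact ⟨s, 1, .loopFalse hb, by omega, hexit v s hs hb⟩

/-- The operations of a non-empty list, given by its head and its tail, one after the other. -/
def block : Op → List Op → Program
  | o, [] => .op o
  | o, o' :: l => .seq (.op o) (block o' l)

theorem exec_block (o : Op) (l : List Op) (s : Store) :
    Exec (block o l) s (l.foldl (fun s o => o.apply s) (o.apply s)) (l.length + 1) := by
  induction l generalizing o s with
  | nil => exact .op o s
  | cons o' l ih =>
    rw [List.length_cons, Nat.add_comm (l.length + 1)]
    exact .seq (.op o s) (ih o' (o.apply s))

theorem Run.block {o : Op} {l : List Op} (hT : l.length + 1 ≤ T)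
    (h : Q (l.foldl (fun s o => o.apply s) (o.apply s))) : Run (block o l) s T Q :=
  ⟨_, _, exec_block o l s, hT, h⟩

end Verification

namespace Reg

/-! The registers; those from `cost` on are real. The programs below assume that `one` and `zero`
hold `1` and `0`. -/

@[simp] abbrev numCand : ℕ := 0
@[simp] abbrev numVoters : ℕ := 1
@[simp] abbrev depth : ℕ := 2
@[simp] abbrev one : ℕ := 3
@[simp] abbrev zero : ℕ := 4
@[simp] abbrev start : ℕ := 5
@[simp] abbrev limit : ℕ := 6
@[simp] abbrev voter : ℕ := 7
@[simp] abbrev row : ℕ := 8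
@[simp] abbrev idx : ℕ := 9
@[simp] abbrev top : ℕ := 10
@[simp] abbrev tmp : ℕ := 11
@[simp] abbrev tmp' : ℕ := 12
@[simp] abbrev void : ℕ := 13
@[simp] abbrev active : ℕ := 14
@[simp] abbrev found : ℕ := 15
@[simp] abbrev count : ℕ := 16
@[simp] abbrev pos : ℕ := 17
@[simp] abbrev cand : ℕ := 18
@[simp] abbrev digit : ℕ := 19
@[simp] abbrev carry : ℕ := 20
@[simp] abbrev cost : ℕ := 0
@[simp] abbrev bestCost : ℕ := 1
@[simp] abbrev fval : ℕ := 2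
@[simp] abbrev factor : ℕ := 3
@[simp] abbrev weight : ℕ := 4

end Reg

/-- Do nothing, in one step. -/
def skip : Program := .op (.natConst Reg.void 0)

/-- The memory `s` with `v` in the natural register `x`. -/
def Store.setNat (s : Store) (x v : ℕ) : Store := { s with nat := Function.update s.nat x v }

theorem Run.skip {s : Store} {Q : Store → Prop} (h : Q s)
    (hQ : ∀ s v, Q s → Q (s.setNat Reg.void v) := by exact fun _ _ h => h) :
    Run skip s 1 Q :=
  .op (hQ s 0 h)

/-- Run `body` for the values of the register `x` from that of the register `a` to that of the
register `b`, exclusively. -/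
def forLoop (x a b : ℕ) (body : Program) : Program :=
  .seq (.op (.natAdd x a Reg.zero))
    (.loop (.natLt x b) (.seq body (.op (.natAdd x x Reg.one))))

theorem Run.forLoop {x ra rb a b T : ℕ} {body : Program} {s : Store} (I : ℕ → Store → Prop)
    (hone : s.nat Reg.one = 1) (hzero : s.nat Reg.zero = 0) (ha : s.nat ra = a)
    (hb : s.nat rb = b) (hab : a ≤ b) (hinit : I a s)
    (hstep : ∀ k s', a ≤ k → k < b → s'.nat x = k → Frame (forLoop x ra rb body) s s' → I k s' →
      Run body s' T (I (k + 1)))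
    (hI : ∀ k s v, I k s → I k (s.setNat x v) := by exact fun _ _ _ h => h)
    (hx : body.anyOp (Op.writesNat x) = false := by rfl)
    (hrb : (forLoop x ra rb body).anyOp (Op.writesNat rb) = false := by rfl)
    (hrone : (forLoop x ra rb body).anyOp (Op.writesNat Reg.one) = false := by rfl) :
    Run (forLoop x ra rb body) s ((b - a) * (T + 2) + 2) (I b) := by
  refine Run.le (T := 1 + ((b - a) * (T + 1 + 1) + 1)) (.seq (.op (Q := fun s' =>
    s'.nat x = a ∧ I a s') ?_) fun s₀ F₀ h₀ => Run.loop (fun v s' => ∃ k, a ≤ k ∧ k ≤ b ∧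
      v = b - k ∧ s'.nat x = k ∧ Frame (RealRAM.forLoop x ra rb body) s s' ∧ I k s') ?_ ?_
    ⟨a, le_rfl, hab, rfl, h₀.1, F₀.seq (.refl _ _), h₀.2⟩) (by lia)
  · have heq : (Op.natAdd x ra Reg.zero).apply s = s.setNat x a := by
      simp only [Op.apply, Store.setNat, ha, hzero, add_zero]
    rw [heq]
    exact ⟨Function.update_self .., hI a s a hinit⟩
  · rintro v s' ⟨k, hak, _, rfl, hk, hF, hIk⟩ hlt
    have hkb' : k < b := by
      have : s'.nat x < s'.nat rb := hlt
      rwa [hk, hF.nat rb hrb, hb] at this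
    refine Run.seq (hstep k s' hak hkb' hk hF hIk) fun s'' hF' hIk' => .op
      ⟨b - (k + 1), by omega, k + 1, by omega, hkb', rfl, ?_⟩
    have hone' : s''.nat Reg.one = 1 := by
      rw [(hF.trans ((Frame.refl _ _).seq (hF'.seq (.refl _ _)).loop)).nat _ hrone, hone]
    have heq : (Op.natAdd x x Reg.one).apply s'' = s''.setNat x (k + 1) := by
      simp only [Op.apply, Store.setNat, hF'.nat x hx, hk, hone']
    exact ⟨by rw [heq]; exact Function.update_self ..,
      hF.trans ((Frame.refl _ _).seq (hF'.seq (.op _ _)).loop), by rw [heq]; exact hI _ _ _ hIk'⟩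
  · rintro v s' ⟨k, _, hkb, rfl, hk, hF, hIk⟩ hlt
    have hle : ¬ s'.nat x < s'.nat rb := hlt
    rw [hk, hF.nat rb hrb, hb] at hle
    obtain rfl : k = b := by omega
    exact hIk

namespace Arr

/-! The arrays. The cells of `votes` and `positions` are grouped by voter, as in the input. -/

@[simp] abbrev votes : ℕ := 0
@[simp] abbrev output : ℕ := 1
@[simp] abbrev positions : ℕ := 2
@[simp] abbrev base : ℕ := 3
@[simp] abbrev topCount : ℕ := 4
@[simp] abbrev digits : ℕ := 5
@[simp] abbrev trial : ℕ := 6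
@[simp] abbrev weights : ℕ := 0
@[simp] abbrev measure : ℕ := 1
@[simp] abbrev fValues : ℕ := 2

end Arr

section

variable {n m i : ℕ} {V : Fin m → Equiv.Perm (Fin n)} {β : ℕ → ℝ} {μ : Fin n → ℝ} {s s' : Store}
  {ω : Equiv.Perm (Fin n)} {Q : Finset (Fin n)}

/-! ## Tables of positions and of values of `f_β` -/

/-- Record the positions of the candidates in the ranking whose row starts at `row`. -/
def invertRow : Program :=
  forLoop Reg.idx Reg.zero Reg.numCand
    (block (.natAdd Reg.tmp Reg.row Reg.idx) [.natLoad Reg.tmp' Arr.votes Reg.tmp,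
      .natAdd Reg.tmp Reg.row Reg.tmp', .natStore Arr.positions Reg.tmp Reg.idx])

/-- Record the positions of the candidates in the rankings of all voters. -/
def voterPositions : Program :=
  .seq (.op (.natConst Reg.row 0))
    (forLoop Reg.voter Reg.zero Reg.numVoters
      (.seq invertRow (.op (.natAdd Reg.row Reg.row Reg.numCand))))

theorem run_invertRow {σ : Equiv.Perm (Fin n)} {r : ℕ} (hn : s.nat Reg.numCand = n)
    (hone : s.nat Reg.one = 1) (hzero : s.nat Reg.zero = 0) (hrow : s.nat Reg.row = r)
    (hσ : ∀ p : Fin n, s.natArr Arr.votes (r + p) = σ p) :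
    Run invertRow s (n * 6 + 2) fun s' =>
      (∀ x : Fin n, s'.natArr Arr.positions (r + x) = σ.symm x) ∧
      ∀ a, (∀ x : Fin n, a ≠ r + x) → s'.natArr Arr.positions a = s.natArr Arr.positions a := by
  refine (Run.forLoop (T := 4) (fun k s' =>
    (∀ x : Fin n, (σ.symm x : ℕ) < k → s'.natArr Arr.positions (r + x) = σ.symm x) ∧
    ∀ a, (∀ x : Fin n, a ≠ r + x) → s'.natArr Arr.positions a = s.natArr Arr.positions a)
    hone hzero hzero hn (Nat.zero_le n) ⟨fun _ h => absurd h (Nat.not_lt_zero _), fun _ _ => rfl⟩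
    ?_).imp fun s' _ h => ⟨fun x => h.1 x (Fin.is_lt _), h.2⟩
  rintro k s' - hk hidx F ⟨hpos, hother⟩
  lift k to Fin n using hk
  have hrow' : s'.nat Reg.row = r := (F.nat _ rfl).trans hrow
  have hvote : s'.natArr Arr.votes (r + k) = σ k := by rw [F.natArr _ rfl, hσ]
  refine .block le_rfl ⟨fun x hx => ?_, fun a ha => ?_⟩
  · rcases eq_or_ne x (σ k) with rfl | hne
    · simp [Op.apply, hidx, hrow', hvote]
    · have hlt : (σ.symm x : ℕ) < k := lt_of_le_of_ne (Nat.lt_succ_iff.1 hx) fun h =>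
        hne (by rw [← Fin.ext h, Equiv.apply_symm_apply])
      simp [Op.apply, hidx, hrow', hvote, Fin.val_ne_of_ne hne, hpos x hlt]
  · simp [Op.apply, hidx, hrow', hvote, ha (σ k), hother a ha]

theorem run_voterPositions (hn : s.nat Reg.numCand = n) (hm : s.nat Reg.numVoters = m)
    (hone : s.nat Reg.one = 1) (hzero : s.nat Reg.zero = 0)
    (hV : ∀ (j : Fin m) (p : Fin n), s.natArr Arr.votes (j * n + p) = V j p) :
    Run voterPositions s (m * (n * 6 + 5) + 3) fun s' =>
      ∀ (j : Fin m) (x : Fin n), s'.natArr Arr.positions (j * n + x) = (V j).symm x := by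
  refine Run.le (T := 1 + ((m - 0) * (n * 6 + 2 + 1 + 2) + 2)) (.seq (.op (Q := fun s' =>
    s'.nat Reg.row = 0) rfl) fun s₁ F₁ hrow => ?_) (by lia)
  refine (Run.forLoop (fun j s' => s'.nat Reg.row = j * n ∧ ∀ j' : Fin m, j' < j → ∀ x : Fin n,
      s'.natArr Arr.positions (j' * n + x) = (V j').symm x)
    ((F₁.nat _ rfl).trans hone) ((F₁.nat _ rfl).trans hzero) ((F₁.nat _ rfl).trans hzero)
    ((F₁.nat _ rfl).trans hm) (Nat.zero_le m) ⟨by rw [hrow, zero_mul], fun _ h =>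
      absurd h (Nat.not_lt_zero _)⟩ ?_).imp fun s' _ h j => h.2 j j.2
  rintro j s₂ - hj - F₂ ⟨hrow₂, hpos⟩
  lift j to Fin m using hj
  have hn₂ : s₂.nat Reg.numCand = n := by rw [F₂.nat _ rfl, F₁.nat _ rfl, hn]
  refine Run.seq (T := n * 6 + 2) (run_invertRow hn₂ (by rw [F₂.nat _ rfl, F₁.nat _ rfl, hone])
    (by rw [F₂.nat _ rfl, F₁.nat _ rfl, hzero]) hrow₂ fun p => by
      rw [F₂.natArr _ rfl, F₁.natArr _ rfl, hV]) fun s₃ F₃ h₃ => .op ⟨?_, fun j' hj' x => ?_⟩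
  · simp [Op.apply, F₃.nat Reg.row rfl, F₃.nat Reg.numCand rfl, hrow₂, hn₂, add_mul]
  rcases Nat.lt_succ_iff_lt_or_eq.1 hj' with hlt | heq
  · refine (h₃.2 _ fun y h => ?_).trans (hpos j' hlt x)
    have hle : ((j' : ℕ) + 1) * n ≤ j * n := Nat.mul_le_mul_right n hlt
    lia
  · obtain rfl := Fin.ext heq
    exact h₃.1 x

/-- The iterated sums of neighbouring weights. They start with `β k` at `t = 0` and end with
`f_β(t)` at `k = 1`, which avoids the computation of binomial coefficients. -/
noncomputable def binomSum (n : ℕ) (β : ℕ → ℝ) (t k : ℕ) : ℝ :=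
  ∑ j ∈ Finset.Icc k n, β j * (t.choose (j - k) : ℝ)

theorem binomSum_zero (β : ℕ → ℝ) {k : ℕ} (hk : k ≤ n) : binomSum n β 0 k = β k := by
  rw [binomSum, Finset.sum_eq_single_of_mem k (Finset.left_mem_Icc.2 hk)]
  · simp
  · intro j hj hne
    rw [Nat.choose_eq_zero_of_lt (by have := (Finset.mem_Icc.1 hj).1; omega), Nat.cast_zero,
      mul_zero]

theorem binomSum_self (n : ℕ) (β : ℕ → ℝ) (t : ℕ) : binomSum n β t n = β n := by
  simp [binomSum]

theorem binomSum_succ (β : ℕ → ℝ) (t : ℕ) {k : ℕ} (hk : k ≤ n) :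
    binomSum n β (t + 1) k = binomSum n β t k + binomSum n β t (k + 1) := by
  simp only [binomSum]
  rw [← Finset.insert_Icc_add_one_left_eq_Icc hk, Finset.sum_insert (by simp),
    Finset.sum_insert (by simp), add_assoc, ← Finset.sum_add_distrib]
  congr 1
  · simp
  · refine Finset.sum_congr rfl fun j hj => ?_
    obtain ⟨d, rfl⟩ := Nat.exists_eq_add_of_le (Finset.mem_Icc.1 hj).1
    rw [show k + 1 + d - k = d + 1 by omega, Nat.add_sub_cancel_left, Nat.choose_succ_succ]
    push_cast
    ring

theorem binomSum_one (hn : 1 ≤ n) {γ : ℕ → ℝ} (h1 : γ 1 = 0)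
    (hγ : ∀ k, 2 ≤ k → k ≤ n → γ k = β k) (t : ℕ) : binomSum n γ t 1 = RankAgg.fBeta n β t := by
  rw [binomSum, RankAgg.fBeta, ← Finset.insert_Icc_add_one_left_eq_Icc hn,
    Finset.sum_insert (by simp), h1, zero_mul, zero_add]
  exact Finset.sum_congr rfl fun k hk => by
    rw [hγ k (Finset.mem_Icc.1 hk).1 (Finset.mem_Icc.1 hk).2]

/-- Replace the sums `binomSum n β t k` in the array `weights` by `binomSum n β (t + 1) k`. -/
def addNeighbours : Program :=
  forLoop Reg.idx Reg.one Reg.numCand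
    (block (.natAdd Reg.tmp Reg.idx Reg.one) [.realLoad Reg.fval Arr.weights Reg.idx,
      .realLoad Reg.factor Arr.weights Reg.tmp, .realAdd Reg.fval Reg.fval Reg.factor,
      .realStore Arr.weights Reg.idx Reg.fval])

/-- Store the values `f_β(t)` with `t < n`, and overwrite the weights. -/
def fTable : Program :=
  forLoop Reg.pos Reg.zero Reg.numCand
    (.seq (block (.realLoad Reg.fval Arr.weights Reg.one) [.realStore Arr.fValues Reg.pos Reg.fval])
      addNeighbours)

theorem run_addNeighbours {γ : ℕ → ℝ} {t : ℕ} (hn1 : 1 ≤ n) (hn : s.nat Reg.numCand = n)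
    (hone : s.nat Reg.one = 1) (hzero : s.nat Reg.zero = 0)
    (hγ : ∀ k, 1 ≤ k → k ≤ n → s.realArr Arr.weights k = binomSum n γ t k) :
    Run addNeighbours s (n * 7 + 2) fun s' =>
      ∀ k, 1 ≤ k → k ≤ n → s'.realArr Arr.weights k = binomSum n γ (t + 1) k := by
  refine Run.le (T := (n - 1) * (5 + 2) + 2) ((Run.forLoop (fun k s' => ∀ k', 1 ≤ k' → k' ≤ n →
    s'.realArr Arr.weights k' = if k' < k then binomSum n γ (t + 1) k' else binomSum n γ t k')
    hone hzero hone hn hn1 (fun k h1 hk => by rw [if_neg (by omega), hγ k h1 hk]) ?_).imp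
    fun s' _ h k h1 hk => ?_) (by omega)
  · intro k s' hk1 hkn hidx F h
    have hone' : s'.nat Reg.one = 1 := (F.nat _ rfl).trans hone
    refine .block le_rfl fun k' hk1' hkn' => ?_
    rcases eq_or_ne k' k with rfl | hne
    · have hk := h k' hk1' hkn'
      have hk_succ := h (k' + 1) (by omega) (by omega)
      rw [if_neg (by omega)] at hk hk_succ
      simp [Op.apply, hidx, hone', hk, hk_succ, binomSum_succ γ t hkn']
    · have hiff : k' < k + 1 ↔ k' < k := by omega
      simp [Op.apply, hidx, hne, h k' hk1' hkn', hiff]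
  · rw [h k h1 hk]
    split_ifs with hlt
    · rfl
    · obtain rfl : k = n := by omega
      rw [binomSum_self, binomSum_self]

theorem run_fTable (hn1 : 1 ≤ n) (hn : s.nat Reg.numCand = n) (hone : s.nat Reg.one = 1)
    (hzero : s.nat Reg.zero = 0) (h1 : s.realArr Arr.weights 1 = 0)
    (hβ : ∀ k, 2 ≤ k → k ≤ n → s.realArr Arr.weights k = β k) :
    Run fTable s (n * (n * 7 + 6) + 2) fun s' =>
      ∀ t < n, s'.realArr Arr.fValues t = RankAgg.fBeta n β t := by
  set γ := s.realArr Arr.weights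
  refine (Run.forLoop (T := n * 7 + 4) (fun t s' =>
    (∀ k, 1 ≤ k → k ≤ n → s'.realArr Arr.weights k = binomSum n γ t k) ∧
      ∀ t' < t, s'.realArr Arr.fValues t' = RankAgg.fBeta n β t')
    hone hzero hzero hn (Nat.zero_le n) ⟨fun k _ hk => (binomSum_zero γ hk).symm,
      fun _ h => absurd h (Nat.not_lt_zero _)⟩ ?_).imp fun _ _ h => h.2
  rintro t s₁ - htn hpos F₁ ⟨hγ, hf⟩
  refine Run.le (T := 2 + (n * 7 + 2)) (Run.seq (Q := fun s' => s'.realArr Arr.weights =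
    s₁.realArr Arr.weights ∧ ∀ t' < t + 1, s'.realArr Arr.fValues t' = RankAgg.fBeta n β t')
    (.block le_rfl ⟨rfl, fun t' ht' => ?_⟩) fun s₂ F₂ h₂ => ?_) (by omega)
  · rcases eq_or_ne t' t with rfl | hne
    · simp [Op.apply, hpos, (F₁.nat Reg.one rfl).trans hone, hγ 1 le_rfl hn1,
        binomSum_one hn1 h1 hβ]
    · simp [Op.apply, hpos, hne, hf t' (by omega)]
  · exact (run_addNeighbours hn1 (by rw [F₂.nat _ rfl, F₁.nat _ rfl, hn])
      (by rw [F₂.nat _ rfl, F₁.nat _ rfl, hone]) (by rw [F₂.nat _ rfl, F₁.nat _ rfl, hzero])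
      (by rwa [h₂.1])).imp fun s₃ F₃ h₃ => ⟨h₃, by rw [F₃.realArr _ rfl]; exact h₂.2⟩

/-- The memory holds the constants, the profile, the measure and the tables that the majority phase
and the search use. -/
structure Tables (V : Fin m → Equiv.Perm (Fin n)) (β : ℕ → ℝ) (μ : Fin n → ℝ) (s : Store) :
    Prop where
  numCand : s.nat Reg.numCand = n
  numVoters : s.nat Reg.numVoters = m
  one : s.nat Reg.one = 1
  zero : s.nat Reg.zero = 0
  votes (j : Fin m) (p : Fin n) : s.natArr Arr.votes (j * n + p) = V j p
  positions (j : Fin m) (x : Fin n) : s.natArr Arr.positions (j * n + x) = (V j).symm x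
  measure (x : Fin n) : s.realArr Arr.measure x = μ x
  fValues : ∀ t < n, s.realArr Arr.fValues t = RankAgg.fBeta n β t

/-- The program does not write the memory that `Tables` describes. -/
def Program.keepsTables (P : Program) : Bool :=
  !([Reg.numCand, Reg.numVoters, Reg.one, Reg.zero].any (fun x => P.anyOp (Op.writesNat x)) ||
    [Arr.votes, Arr.positions].any (fun A => P.anyOp (Op.writesNatArr A)) ||
    [Arr.measure, Arr.fValues].any (fun A => P.anyOp (Op.writesRealArr A)))

theorem Tables.frame {P : Program} (h : Tables V β μ s) (F : Frame P s s')
    (hP : P.keepsTables = true := by rfl) : Tables V β μ s' := by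
  simp only [Program.keepsTables, List.any_cons, List.any_nil, Bool.or_false, Bool.not_eq_true',
    Bool.or_eq_false_iff] at hP
  obtain ⟨⟨⟨hn, hm, hone, hzero⟩, hvotes, hpositions⟩, hmeasure, hf⟩ := hP
  refine ⟨(F.nat _ hn).trans h.numCand, (F.nat _ hm).trans h.numVoters,
    (F.nat _ hone).trans h.one, (F.nat _ hzero).trans h.zero, ?_, ?_, ?_, ?_⟩
  · rw [F.natArr _ hvotes]; exact h.votes
  · rw [F.natArr _ hpositions]; exact h.positions
  · rw [F.realArr _ hmeasure]; exact h.measure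
  · rw [F.realArr _ hf]; exact h.fValues

/-- The natural array `A` holds the ranking `ω`. -/
def Holds (A : ℕ) (ω : Equiv.Perm (Fin n)) (s : Store) : Prop :=
  ∀ p : Fin n, s.natArr A p = ω p

theorem Holds.frame {A : ℕ} {P : Program} (h : Holds A ω s) (F : Frame P s s')
    (hP : P.anyOp (Op.writesNatArr A) = false := by rfl) : Holds A ω s' := by
  rw [Holds, F.natArr A hP]
  exact h

/-- Exchange the cells of the natural array `A` whose addresses are in the registers `a` and `b`. -/
def swapCells (A a b : ℕ) : Program :=
  block (.natLoad Reg.tmp A a)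
    [.natLoad Reg.tmp' A b, .natStore A a Reg.tmp', .natStore A b Reg.tmp]

theorem run_swapCells {A a b : ℕ} (h : Holds A ω s) {p q : Fin n} (hp : s.nat a = p)
    (hq : s.nat b = q) (ha : a ≠ Reg.tmp ∧ a ≠ Reg.tmp' := by decide)
    (hb : b ≠ Reg.tmp ∧ b ≠ Reg.tmp' := by decide) :
    Run (swapCells A a b) s 4 (Holds A (ω * Equiv.swap p q)) := by
  refine .block le_rfl fun r => ?_
  have hval : (([.natLoad Reg.tmp' A b, .natStore A a Reg.tmp', .natStore A b Reg.tmp].foldl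
      (fun s o => Op.apply o s) ((Op.natLoad Reg.tmp A a).apply s)).natArr A r : ℕ) =
      if (r : ℕ) = q then s.natArr A p else if (r : ℕ) = p then s.natArr A q
      else s.natArr A r := by
    simp [Op.apply, Function.update_apply, ha.1, ha.2, hb.1, hb.2, hp, hq]
  rw [hval, Equiv.Perm.mul_apply, Equiv.swap_apply_def, h p, h q, h r]
  grind

/-- Copy the first `n` cells of the natural array `A` to the natural array `B`. -/
def copyArr (A B : ℕ) : Program :=
  forLoop Reg.idx Reg.zero Reg.numCand
    (block (.natLoad Reg.tmp A Reg.idx) [.natStore B Reg.idx Reg.tmp])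

theorem run_copyArr {A B : ℕ} (hAB : A ≠ B) (hT : Tables V β μ s) (h : Holds A ω s) :
    Run (copyArr A B) s (n * 4 + 2) (Holds B ω) := by
  refine (Run.forLoop (T := 2) (fun k s' => Holds A ω s' ∧
    ∀ p : Fin n, (p : ℕ) < k → s'.natArr B p = ω p) hT.one hT.zero hT.zero hT.numCand
    (Nat.zero_le n) ⟨h, fun _ h => absurd h (Nat.not_lt_zero _)⟩ ?_).imp fun s' _ h p => h.2 p p.2
  rintro k s' - hk hidx - ⟨hA, hB⟩
  lift k to Fin n using hk
  refine .block le_rfl ⟨fun p => ?_, fun p hp => ?_⟩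
  · simp [Op.apply, hAB, hA p]
  · rcases eq_or_ne p k with rfl | hne
    · simp [Op.apply, hidx, hA p]
    · have := Fin.val_ne_of_ne hne
      simp [Op.apply, hidx, this, hB p (by omega)]

/-! ## The majority phase -/

/-- Find the position from `start` on, in the ranking `base`, of the favourite of the voter whose
row starts at `row`. -/
def voterTop : Program :=
  .seq (.op (.natAdd Reg.top Reg.start Reg.zero))
    (forLoop Reg.idx Reg.start Reg.numCand
      (.seq (block (.natLoad Reg.tmp Arr.base Reg.idx) [.natLoad Reg.tmp' Arr.base Reg.top,
          .natAdd Reg.tmp Reg.row Reg.tmp, .natAdd Reg.tmp' Reg.row Reg.tmp',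
          .natLoad Reg.tmp Arr.positions Reg.tmp, .natLoad Reg.tmp' Arr.positions Reg.tmp'])
        (.ite (.natLt Reg.tmp Reg.tmp') (.op (.natAdd Reg.top Reg.idx Reg.zero)) skip)))

theorem run_voterTop {j : Fin m} (hT : Tables V β μ s) (hω : Holds Arr.base ω s) (hi : i < n)
    (hstart : s.nat Reg.start = i) (hrow : s.nat Reg.row = j * n)
    (hQ : ∀ x, x ∈ Q ↔ i ≤ ω.symm x) :
    Run voterTop s (n * 10 + 3) fun s' =>
      ∃ r : Fin n, s'.nat Reg.top = r ∧ ω r ∈ RankAgg.best Q (V j) := by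
  refine Run.le (T := 1 + ((n - i) * (6 + (1 + 1) + 2) + 2)) (.seq (.op (Q := fun s' =>
    s'.nat Reg.top = i) (by simp [Op.apply, hstart, hT.zero])) fun s₁ F₁ htop => ?_) (by omega)
  have hT₁ := hT.frame F₁
  refine (Run.forLoop (fun k s' => ∃ r : Fin n, s'.nat Reg.top = r ∧ i ≤ r ∧
    ∀ r' : Fin n, i ≤ r' → (r' : ℕ) < k → (V j).symm (ω r) ≤ (V j).symm (ω r')) hT₁.one hT₁.zero
    ((F₁.nat _ rfl).trans hstart) hT₁.numCand hi.le ⟨⟨i, hi⟩, htop, le_rfl, fun r' _ _ => by omega⟩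
    ?_).imp fun s' _ ⟨r, htop, hr, hmin⟩ => ⟨r, htop, RankAgg.mem_best.2 ⟨(hQ _).2 (by simpa),
      fun y hy hne => ?_⟩⟩
  · rintro k s₂ hik hk hidx F₂ ⟨r, htop₂, hr, hmin⟩
    lift k to Fin n using hk
    have hT₂ := hT₁.frame F₂
    have hω₂ := (hω.frame F₁).frame F₂
    have hrow₂ : s₂.nat Reg.row = j * n := by rw [F₂.nat _ rfl, F₁.nat _ rfl, hrow]
    refine Run.seq (Q := fun s' => s'.nat Reg.tmp = (V j).symm (ω k) ∧
      s'.nat Reg.tmp' = (V j).symm (ω r)) (.block le_rfl ?_) fun s₃ F₃ h₃ =>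
        .ite_natLt h₃.1 h₃.2 (fun hlt => .op ⟨k, ?_, hik, fun r' h1 h2 => ?_⟩)
          (fun hle => .skip ⟨r, (F₃.nat _ rfl).trans htop₂, hr, fun r' h1 h2 => ?_⟩)
    · simp [Op.apply, hidx, htop₂, hrow₂, hω₂ k, hω₂ r, hT₂.positions]
    · simp [Op.apply, F₃.nat Reg.idx rfl, hidx, (hT₂.frame F₃).zero]
    · rcases Nat.lt_succ_iff_lt_or_eq.1 h2 with h | h
      · exact hlt.le.trans (hmin r' h1 h)
      · rw [Fin.ext h]
    · rcases Nat.lt_succ_iff_lt_or_eq.1 h2 with h | h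
      · exact hmin r' h1 h
      · rwa [Fin.ext h]
  · have hle := hmin (ω.symm y) ((hQ y).1 hy) (Fin.is_lt _)
    rw [Equiv.apply_symm_apply] at hle
    exact lt_of_le_of_ne hle fun h => hne ((V j).symm.injective h).symm

theorem sum_filter_val_lt_succ {M : Type*} [AddCommMonoid M] (k : Fin n) (f : Fin n → M) :
    ∑ j ∈ Finset.univ.filter fun j : Fin n => (j : ℕ) < k + 1, f j =
      ∑ j ∈ Finset.univ.filter fun j : Fin n => (j : ℕ) < k, f j + f k := by
  have hinsert : (Finset.univ.filter fun j : Fin n => (j : ℕ) < k + 1) =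
      insert k (Finset.univ.filter fun j : Fin n => (j : ℕ) < k) := by
    ext j
    grind
  rw [hinsert, Finset.sum_insert (by simp), add_comm]

theorem card_filter_val_lt_succ (k : Fin n) (p : Fin n → Prop) [DecidablePred p] :
    (Finset.univ.filter fun j : Fin n => (j : ℕ) < k + 1 ∧ p j).card =
      (Finset.univ.filter fun j : Fin n => (j : ℕ) < k ∧ p j).card + if p k then 1 else 0 := by
  simp only [← Finset.filter_filter, Finset.card_filter p, sum_filter_val_lt_succ]

/-- Count, for each position in the ranking `base`, the voters whose favourite from `start` on is
at this position. -/
def countTops : Program :=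
  .seq (forLoop Reg.idx Reg.zero Reg.numCand (.op (.natStore Arr.topCount Reg.idx Reg.zero)))
    (.seq (.op (.natConst Reg.row 0))
      (forLoop Reg.voter Reg.zero Reg.numVoters
        (.seq voterTop (block (.natLoad Reg.tmp Arr.topCount Reg.top)
          [.natAdd Reg.tmp Reg.tmp Reg.one, .natStore Arr.topCount Reg.top Reg.tmp,
            .natAdd Reg.row Reg.row Reg.numCand]))))

/-- The array `topCount` holds, for each position in `ω`, the number of the voters `j < k` whose
favourite in `Q` is the candidate at this position. -/
def CountsTops (V : Fin m → Equiv.Perm (Fin n)) (ω : Equiv.Perm (Fin n)) (Q : Finset (Fin n))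
    (k : ℕ) (s : Store) : Prop :=
  ∀ r : Fin n, s.natArr Arr.topCount r =
    (Finset.univ.filter fun j : Fin m => (j : ℕ) < k ∧ ω r ∈ RankAgg.best Q (V j)).card

theorem run_countTops (hT : Tables V β μ s) (hω : Holds Arr.base ω s) (hi : i < n)
    (hstart : s.nat Reg.start = i) (hQ : ∀ x, x ∈ Q ↔ i ≤ ω.symm x) :
    Run countTops s (n * 3 + m * (n * 10 + 9) + 5) (CountsTops V ω Q m) := by
  refine Run.le (T := (n - 0) * (1 + 2) + 2 + (1 + ((m - 0) * (n * 10 + 3 + 4 + 2) + 2)))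
    (.seq (.forLoop (fun k s' => ∀ r < k, s'.natArr Arr.topCount r = 0) hT.one hT.zero hT.zero
      hT.numCand (Nat.zero_le n) (fun _ h => absurd h (Nat.not_lt_zero _)) fun k s' _ _ hidx F h =>
        .op fun r hr => ?_) fun s₁ F₁ hzero => .seq (.op (Q := fun s' => s'.nat Reg.row = 0 ∧
          ∀ r < n, s'.natArr Arr.topCount r = 0) ⟨rfl, hzero⟩) fun s₂ F₂ h₂ => ?_) (by lia)
  · rcases eq_or_ne r k with rfl | hne
    · simp [Op.apply, hidx, (hT.frame F).zero]
    · simp [Op.apply, hidx, hne, h r (by omega)]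
  have hT₂ := (hT.frame F₁).frame F₂
  refine (Run.forLoop (fun k s' => s'.nat Reg.row = k * n ∧ CountsTops V ω Q k s') hT₂.one hT₂.zero
    hT₂.zero hT₂.numVoters (Nat.zero_le m) ⟨by rw [h₂.1, zero_mul], fun r => by simp [h₂.2 r r.2]⟩
    ?_).imp fun s' _ h => h.2
  rintro j s₃ - hj - F₃ ⟨hrow, hcount⟩
  lift j to Fin m using hj
  have hT₃ := hT₂.frame F₃
  refine .seq (T := n * 10 + 3) (T' := 4) (run_voterTop hT₃ (((hω.frame F₁).frame F₂).frame F₃) hi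
    (by rw [F₃.nat _ rfl, F₂.nat _ rfl, F₁.nat _ rfl, hstart]) hrow hQ) ?_
  rintro s₄ F₄ ⟨b, htop, hb⟩
  have hT₄ := hT₃.frame F₄
  refine .block le_rfl ⟨by simp [Op.apply, F₄.nat Reg.row rfl, hrow, hT₄.numCand, add_mul],
    fun r => ?_⟩
  have hmem : ω r ∈ RankAgg.best Q (V j) ↔ r = b := by
    rw [RankAgg.best_eq_singleton hb, Finset.mem_singleton, ω.apply_eq_iff_eq]
  simp only [card_filter_val_lt_succ, hmem, ← hcount r, ← F₄.natArr Arr.topCount rfl]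
  rcases eq_or_ne r b with rfl | hne
  · simp [Op.apply, htop, hT₄.one]
  · simp [Op.apply, htop, hne, Fin.val_ne_of_ne hne]

/-- Put a position whose candidate is the favourite of more than half of the voters into the
register `found`, or the number of candidates if there is no such position. -/
def findMajority : Program :=
  .seq (.op (.natAdd Reg.found Reg.numCand Reg.zero))
    (forLoop Reg.idx Reg.zero Reg.numCand
      (.seq (block (.natLoad Reg.tmp Arr.topCount Reg.idx) [.natAdd Reg.tmp Reg.tmp Reg.tmp])
        (.ite (.natLt Reg.numVoters Reg.tmp) (.op (.natAdd Reg.found Reg.idx Reg.zero)) skip)))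

theorem run_findMajority (hT : Tables V β μ s) (hcount : CountsTops V ω Q m s) :
    Run findMajority s (n * 6 + 3) fun s' =>
      (s'.nat Reg.found = n ∧ ¬ ∃ c, RankAgg.IsMajority V Q c) ∨
        ∃ r : Fin n, s'.nat Reg.found = r ∧ RankAgg.IsMajority V Q (ω r) := by
  refine Run.le (T := 1 + ((n - 0) * (2 + (1 + 1) + 2) + 2)) (.seq (.op (Q := fun s' =>
    s'.nat Reg.found = n ∧ CountsTops V ω Q m s') ⟨by simp [Op.apply, hT.numCand, hT.zero], hcount⟩)
      fun s₁ F₁ h₁ => ?_) (by omega)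
  have hT₁ := hT.frame F₁
  refine (Run.forLoop (fun k s' =>
    (s'.nat Reg.found = n ∧ ∀ r : Fin n, r < k → ¬ RankAgg.IsMajority V Q (ω r)) ∨
      ∃ r : Fin n, s'.nat Reg.found = r ∧ RankAgg.IsMajority V Q (ω r)) hT₁.one hT₁.zero hT₁.zero
    hT₁.numCand (Nat.zero_le n) (.inl ⟨h₁.1, fun _ h => absurd h (Nat.not_lt_zero _)⟩) ?_).imp
    fun s' _ h => h.imp_left fun h => ⟨h.1, fun ⟨c, hc⟩ => h.2 (ω.symm c) (Fin.is_lt _) (by simpa)⟩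
  rintro k s₂ - hk hidx F₂ hI
  lift k to Fin n using hk
  have hT₂ := hT₁.frame F₂
  have hk_iff : RankAgg.IsMajority V Q (ω k) ↔
      m < s₂.natArr Arr.topCount k + s₂.natArr Arr.topCount k := by
    rw [F₂.natArr _ rfl, h₁.2 k, RankAgg.isMajority_iff, two_mul]
    simp
  refine .seq (.block (Q := fun s' => s'.nat Reg.tmp =
    s₂.natArr Arr.topCount k + s₂.natArr Arr.topCount k) le_rfl (by simp [Op.apply, hidx]))
    fun s₃ F₃ htmp => .ite_natLt ((hT₂.frame F₃).numVoters) htmp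
      (fun hlt => .op (.inr ⟨k, ?_, hk_iff.2 hlt⟩)) fun hle => .skip ?_
  · simp [Op.apply, F₃.nat Reg.idx rfl, hidx, (hT₂.frame F₃).zero]
  · rw [F₃.nat _ rfl]
    refine hI.imp_left fun h => ⟨h.1, fun r hr => ?_⟩
    rcases Nat.lt_succ_iff_lt_or_eq.1 hr with hlt | heq
    · exact h.2 r hlt
    · rw [Fin.ext heq, hk_iff]
      exact not_lt.2 hle

/-- The memory represents the state of the while-loop of the algorithm: the array `base` starts
with the placed candidates `l`, and the register `start` holds their number. -/
structure MajorityState (V : Fin m → Equiv.Perm (Fin n)) (ω : Equiv.Perm (Fin n))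
    (l : List (Fin n)) (Q : Finset (Fin n)) (s : Store) : Prop where
  base : Holds Arr.base ω s
  start : s.nat Reg.start = l.length
  startsWith : RankAgg.StartsWith ω l
  reaches : RankAgg.LoopReaches V l Q

theorem MajorityState.frame {l : List (Fin n)} {P : Program} (h : MajorityState V ω l Q s)
    (F : Frame P s s') (hbase : P.anyOp (Op.writesNatArr Arr.base) = false := by rfl)
    (hstart : P.anyOp (Op.writesNat Reg.start) = false := by rfl) : MajorityState V ω l Q s' :=
  ⟨h.base.frame F hbase, (F.nat _ hstart).trans h.start, h.startsWith, h.reaches⟩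

/-- Move the candidate in position `found` to position `start`, and increase `start`. -/
def placeFound : Program :=
  .seq (swapCells Arr.base Reg.start Reg.found) (.op (.natAdd Reg.start Reg.start Reg.one))

theorem run_placeFound {l : List (Fin n)} (hone : s.nat Reg.one = 1)
    (h : MajorityState V ω l Q s) {r : Fin n} (hfound : s.nat Reg.found = r)
    (hr : RankAgg.IsMajority V Q (ω r)) :
    Run placeFound s 5 fun s' => ∃ ω' l' Q', MajorityState V ω' l' Q' s' ∧
      l'.length = l.length + 1 := by
  have hlr : l.length ≤ r := by simpa using (h.reaches.mem_iff h.startsWith (ω r)).1 hr.1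
  have hln : l.length < n := hlr.trans_lt r.2
  refine .seq (T := 4) (T' := 1) (run_swapCells h.base (p := ⟨l.length, hln⟩) h.start hfound)
    fun s₁ F₁ hbase => .op ⟨_, l ++ [ω r], Q.erase (ω r), ⟨hbase, ?_, ?_, h.reaches.step hr⟩,
      List.length_append⟩
  · simp [Op.apply, F₁.nat Reg.start rfl, h.start, F₁.nat Reg.one rfl, hone]
  · refine (RankAgg.startsWith_append_singleton_iff hln).2
      ⟨h.startsWith.mul_swap le_rfl hlr, ?_⟩
    rw [RankAgg.symm_mul_swap_apply, Equiv.symm_apply_apply, Equiv.swap_apply_right]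

/-- One round of the while-loop of the algorithm. The last round sets `active` to `0`. -/
def majorityStep : Program :=
  .seq countTops (.seq findMajority (.ite (.natLt Reg.found Reg.numCand) placeFound
    (.op (.natConst Reg.active 0))))

theorem run_majorityStep {l : List (Fin n)} (hT : Tables V β μ s) (h : MajorityState V ω l Q s)
    (hl : l.length < n) :
    Run majorityStep s (n * 9 + m * (n * 10 + 9) + 14) fun s' =>
      (s'.nat Reg.active = s.nat Reg.active ∧ ∃ ω' l' Q', MajorityState V ω' l' Q' s' ∧
        l'.length = l.length + 1) ∨
      (s'.nat Reg.active = 0 ∧ MajorityState V ω l Q s' ∧ ¬ ∃ c, RankAgg.IsMajority V Q c) := by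
  refine Run.le (T := n * 3 + m * (n * 10 + 9) + 5 + (n * 6 + 3 + (5 + 1)))
    (.seq (run_countTops hT h.base hl h.start (h.reaches.mem_iff h.startsWith))
      fun s₁ F₁ hcount => .seq (run_findMajority (hT.frame F₁) hcount)
        fun s₂ F₂ hfound => ?_) (by omega)
  have hT₂ := (hT.frame F₁).frame F₂
  have h₂ := (h.frame F₁).frame F₂
  have hactive : s₂.nat Reg.active = s.nat Reg.active := by rw [F₂.nat _ rfl, F₁.nat _ rfl]
  rcases hfound with ⟨hfound, hno⟩ | ⟨r, hfound, hr⟩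
  · exact .ite_natLt hfound hT₂.numCand (fun h => absurd h (lt_irrefl n)) fun _ =>
      Run.le (T := 1) (.op (.inr ⟨rfl, ⟨h₂.base, h₂.start, h₂.startsWith, h₂.reaches⟩, hno⟩))
        (by norm_num)
  · exact .ite_natLt hfound hT₂.numCand (fun _ => (run_placeFound hT₂.one h₂ hfound hr).imp
      fun s' F h' => .inl ⟨(F.nat _ rfl).trans hactive, h'⟩) fun h => absurd h (not_le.2 r.2)

/-- Place the majority candidates. -/
def majorityPhase : Program :=
  .seq (forLoop Reg.idx Reg.zero Reg.numCand (.op (.natStore Arr.base Reg.idx Reg.idx)))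
    (.seq (block (.natConst Reg.start 0) [.natAdd Reg.active Reg.numCand Reg.zero])
      (.loop (.natLt Reg.start Reg.active) majorityStep))

theorem run_majorityPhase (hT : Tables V β μ s) :
    Run majorityPhase s (n * (n * 9 + m * (n * 10 + 9) + 18) + 5) fun s' =>
      ∃ ω l Q, MajorityState V ω l Q s' ∧ ¬ ∃ c, RankAgg.IsMajority V Q c := by
  refine Run.le (T := (n - 0) * (1 + 2) + 2 + (2 + (n * (n * 9 + m * (n * 10 + 9) + 14 + 1) + 1)))
    (.seq (.forLoop (fun k s' => ∀ p < k, s'.natArr Arr.base p = p) hT.one hT.zero hT.zero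
      hT.numCand (Nat.zero_le n) (fun _ h => absurd h (Nat.not_lt_zero _)) fun k s' _ _ hidx _ h =>
        .op fun p hp => ?_) fun s₁ F₁ hid => .seq (.block (Q := fun s' => s'.nat Reg.active = n ∧
          MajorityState V 1 [] Finset.univ s') le_rfl ⟨?_, ⟨fun p => hid p p.2, rfl, ?_, .start⟩⟩)
            fun s₂ F₂ h₂ => ?_) (by lia)
  · rcases eq_or_ne p k with rfl | hne
    · simp [Op.apply, hidx]
    · simp [Op.apply, hidx, hne, h p (by omega)]
  · simp [Op.apply, F₁.nat Reg.numCand rfl, hT.numCand, F₁.nat Reg.zero rfl, hT.zero]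
  · exact fun p h => absurd h (Nat.not_lt_zero _)
  refine Run.loop (fun v s' => Tables V β μ s' ∧ ∃ ω l Q, MajorityState V ω l Q s' ∧
    (s'.nat Reg.active = n ∧ v = n - l.length ∨
      s'.nat Reg.active = 0 ∧ ¬ ∃ c, RankAgg.IsMajority V Q c)) ?_ ?_
    ⟨(hT.frame F₁).frame F₂, _, _, _, h₂.2, .inl ⟨h₂.1, rfl⟩⟩
  · rintro v s₃ ⟨hT₃, ω, l, Q, h, ⟨hactive, rfl⟩ | ⟨hactive, -⟩⟩ hlt
    · have hl : l.length < n := by simpa only [Test.Holds, h.start, hactive] using hlt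
      refine (run_majorityStep hT₃ h hl).imp fun s₄ F₄ h₄ => ?_
      rcases h₄ with ⟨hactive₄, ω', l', Q', h', hl'⟩ | ⟨hactive₄, h', hno⟩
      · exact ⟨_, by omega, hT₃.frame F₄, ω', l', Q', h', .inl ⟨hactive₄.trans hactive, rfl⟩⟩
      · exact ⟨0, by omega, hT₃.frame F₄, ω, l, Q, h', .inr ⟨hactive₄, hno⟩⟩
    · exact absurd hlt (by simp [Test.Holds, hactive])
  · rintro v s₃ ⟨-, ω, l, Q, h, ⟨hactive, -⟩ | ⟨-, hno⟩⟩ hlt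
    · have hcard := h.reaches.card_add_length
      have hQ : Q = ∅ := Finset.card_eq_zero.1 (by
        simp only [Test.Holds, h.start, hactive] at hlt
        omega)
      exact ⟨ω, l, Q, h, fun ⟨c, hc⟩ => by simpa [hQ] using hc.1⟩
    · exact ⟨ω, l, Q, h, hno⟩

/-! ## Evaluation of a ranking -/

/-- Count the candidates below the position `pos` of the ranking `trial` that the voter whose row
starts at `row` places below the candidate `cand`. -/
def countBelow : Program :=
  .seq (block (.natAdd Reg.tmp Reg.row Reg.cand)
      [.natLoad Reg.tmp' Arr.positions Reg.tmp, .natConst Reg.count 0])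
    (forLoop Reg.idx Reg.pos Reg.numCand
      (.seq (block (.natLoad Reg.tmp Arr.trial Reg.idx)
          [.natAdd Reg.tmp Reg.row Reg.tmp, .natLoad Reg.tmp Arr.positions Reg.tmp])
        (.ite (.natLt Reg.tmp' Reg.tmp) (.op (.natAdd Reg.count Reg.count Reg.one)) skip)))

/-- Add the contribution of a voter and a position to the register `cost`. -/
def addPosTerm : Program :=
  .seq countBelow
    (block (.natAdd Reg.tmp Reg.row Reg.pos) [.natLoad Reg.tmp Arr.votes Reg.tmp,
      .realLoad Reg.factor Arr.measure Reg.tmp, .realAdd Reg.factor Reg.weight Reg.factor,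
      .realMul Reg.factor Reg.fval Reg.factor, .realAdd Reg.cost Reg.cost Reg.factor,
      .realLoad Reg.factor Arr.fValues Reg.count, .realMul Reg.factor Reg.factor Reg.weight,
      .realSub Reg.cost Reg.cost Reg.factor, .realSub Reg.cost Reg.cost Reg.factor,
      .natAdd Reg.row Reg.row Reg.numCand])

/-- Add the contributions of all voters for the position `pos` to the register `cost`. -/
def addPosition : Program :=
  .seq (block (.natLoad Reg.cand Arr.trial Reg.pos) [.natSub Reg.tmp Reg.numCand Reg.pos,
      .natSub Reg.tmp Reg.tmp Reg.one, .realLoad Reg.fval Arr.fValues Reg.tmp,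
      .realLoad Reg.weight Arr.measure Reg.cand, .natConst Reg.row 0])
    (forLoop Reg.voter Reg.zero Reg.numVoters addPosTerm)

/-- Put into the register `cost` the distance of the ranking `trial` to the profile, truncated to
the positions from `start` to `limit`, exclusively. -/
def evalTrial : Program :=
  .seq (.op (.realConst Reg.cost 0)) (forLoop Reg.pos Reg.start Reg.limit addPosition)

theorem card_below_inter_below (ω σ : Equiv.Perm (Fin n)) (p : Fin n) :
    (RankAgg.below ω (ω p) ∩ RankAgg.below σ (ω p)).card =
      (Finset.univ.filter fun r : Fin n => (r : ℕ) < n ∧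
        p ≤ r ∧ RankAgg.Prefers σ (ω p) (ω r)).card := by
  have hmap : RankAgg.below ω (ω p) ∩ RankAgg.below σ (ω p) =
      (Finset.univ.filter fun r : Fin n => (r : ℕ) < n ∧
        p ≤ r ∧ RankAgg.Prefers σ (ω p) (ω r)).map ω.toEmbedding := by
    ext x
    obtain ⟨r, rfl⟩ := ω.surjective x
    rw [Finset.mem_inter, RankAgg.mem_below, RankAgg.mem_below, Finset.mem_map_equiv,
      Finset.mem_filter_univ, Equiv.symm_apply_apply, ← and_assoc, and_iff_right r.2]
    refine and_congr_left fun h => ?_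
    have hne : p ≠ r := by
      rintro rfl
      exact lt_irrefl _ h
    rw [RankAgg.Prefers, Equiv.symm_apply_apply, Equiv.symm_apply_apply, hne.le_iff_lt]
  rw [hmap, Finset.card_map]

theorem run_countBelow (hT : Tables V β μ s) (hω : Holds Arr.trial ω s) {j : Fin m} {p : Fin n}
    (hrow : s.nat Reg.row = j * n) (hpos : s.nat Reg.pos = p) (hcand : s.nat Reg.cand = ω p) :
    Run countBelow s (n * 7 + 5) fun s' =>
      s'.nat Reg.count = (RankAgg.below ω (ω p) ∩ RankAgg.below (V j) (ω p)).card := by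
  rw [card_below_inter_below]
  refine Run.le (T := 3 + ((n - p) * (3 + (1 + 1) + 2) + 2)) (.seq (.block (Q := fun s' =>
    s'.nat Reg.count = 0 ∧ s'.nat Reg.tmp' = (V j).symm (ω p)) le_rfl ?_) fun s₁ F₁ h₁ => ?_)
    (by omega)
  · simp [Op.apply, hrow, hcand, hT.positions]
  have hT₁ := hT.frame F₁
  refine Run.forLoop (fun k s' => s'.nat Reg.count = (Finset.univ.filter fun r : Fin n =>
      (r : ℕ) < k ∧ p ≤ r ∧ RankAgg.Prefers (V j) (ω p) (ω r)).card) hT₁.one hT₁.zero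
    ((F₁.nat _ rfl).trans hpos) hT₁.numCand p.2.le ?_ ?_
  · rw [h₁.1, eq_comm, Finset.card_eq_zero, Finset.filter_eq_empty_iff]
    exact fun r _ h => absurd h.1 (not_lt.2 h.2.1)
  rintro k s₂ hpk hk hidx F₂ hcount
  lift k to Fin n using hk
  have hT₂ := hT₁.frame F₂
  have hω₂ := (hω.frame F₁).frame F₂
  have hrow₂ : s₂.nat Reg.row = j * n := by rw [F₂.nat _ rfl, F₁.nat _ rfl, hrow]
  rw [card_filter_val_lt_succ, ← hcount]
  refine Run.seq (Q := fun s' => s'.nat Reg.tmp = (V j).symm (ω k)) (.block le_rfl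
    (by simp [Op.apply, hidx, hω₂ k, hrow₂, hT₂.positions])) fun s₃ F₃ htmp => .ite_natLt
      (by rw [F₃.nat _ rfl, F₂.nat _ rfl, h₁.2]) htmp (fun hlt => .op ?_) fun hle => .skip ?_
  · simp [Op.apply, F₃.nat Reg.count rfl, (hT₂.frame F₃).one,
      if_pos (show p ≤ k ∧ RankAgg.Prefers (V j) (ω p) (ω k) from ⟨hpk, hlt⟩)]
  · rw [F₃.nat _ rfl, if_neg fun h => not_lt.2 hle h.2, add_zero]

theorem run_addPosTerm (hT : Tables V β μ s) (hω : Holds Arr.trial ω s) {j : Fin m} {p : Fin n}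
    (hrow : s.nat Reg.row = j * n) (hpos : s.nat Reg.pos = p) (hcand : s.nat Reg.cand = ω p)
    (hfval : s.real Reg.fval = RankAgg.fBeta n β (n - (p + 1)))
    (hweight : s.real Reg.weight = μ (ω p)) :
    Run addPosTerm s (n * 7 + 16) fun s' => s'.nat Reg.row = (j + 1) * n ∧
      s'.real Reg.cost = s.real Reg.cost + RankAgg.posTerm β μ ω (V j) p := by
  refine .seq (T := n * 7 + 5) (T' := 11) (run_countBelow hT hω hrow hpos hcand)
    fun s₁ F₁ hcount => .block le_rfl ⟨?_, ?_⟩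
  · simp [Op.apply, F₁.nat Reg.row rfl, hrow, F₁.nat Reg.numCand rfl, hT.numCand, add_mul]
  have hT₁ := hT.frame F₁
  have hlt : (RankAgg.below ω (ω p) ∩ RankAgg.below (V j) (ω p)).card < n := by
    have hle := Finset.card_le_card (Finset.inter_subset_left :
      RankAgg.below ω (ω p) ∩ RankAgg.below (V j) (ω p) ⊆ _)
    rw [RankAgg.card_below] at hle
    omega
  simp [Op.apply, F₁.nat Reg.row rfl, hrow, F₁.nat Reg.pos rfl, hpos, F₁.real Reg.cost rfl,
    F₁.real Reg.fval rfl, hfval, F₁.real Reg.weight rfl, hweight, hcount, hT₁.votes, hT₁.measure,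
    hT₁.fValues _ hlt, RankAgg.posTerm]
  ring

theorem run_addPosition (hT : Tables V β μ s) (hω : Holds Arr.trial ω s) {p : Fin n}
    (hpos : s.nat Reg.pos = p) :
    Run addPosition s (m * (n * 7 + 18) + 8) fun s' =>
      s'.real Reg.cost = s.real Reg.cost + ∑ j, RankAgg.posTerm β μ ω (V j) p := by
  refine Run.le (T := 6 + ((m - 0) * (n * 7 + 16 + 2) + 2)) (.seq (.block (Q := fun s' =>
    s'.nat Reg.row = 0 ∧ s'.nat Reg.cand = ω p ∧ s'.real Reg.cost = s.real Reg.cost ∧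
    s'.real Reg.fval = RankAgg.fBeta n β (n - (p + 1)) ∧ s'.real Reg.weight = μ (ω p)) le_rfl ?_)
    fun s₁ F₁ h₁ => ?_) (by lia)
  · simp [Op.apply, hpos, hω p, hT.numCand, hT.one, hT.measure, Nat.sub_sub,
      hT.fValues (n - (p + 1)) (by omega)]
  obtain ⟨hrow, hcand, hcost, hfval, hweight⟩ := h₁
  have hT₁ := hT.frame F₁
  refine (Run.forLoop (fun k s' => s'.nat Reg.row = k * n ∧
    s'.real Reg.cost = s.real Reg.cost + ∑ j ∈ Finset.univ.filter fun j : Fin m => (j : ℕ) < k,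
      RankAgg.posTerm β μ ω (V j) p) hT₁.one hT₁.zero hT₁.zero hT₁.numVoters (Nat.zero_le m)
    (by simp [hrow, hcost]) ?_).imp fun s' _ h => by simpa using h.2
  rintro j s₂ - hj - F₂ ⟨hrow₂, hcost₂⟩
  lift j to Fin m using hj
  refine (run_addPosTerm (hT₁.frame F₂) ((hω.frame F₁).frame F₂) hrow₂
    (by rw [F₂.nat _ rfl, F₁.nat _ rfl, hpos]) ((F₂.nat _ rfl).trans hcand)
    ((F₂.real _ rfl).trans hfval) ((F₂.real _ rfl).trans hweight)).imp fun s' _ h => ⟨h.1, ?_⟩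
  rw [h.2, hcost₂, sum_filter_val_lt_succ, add_assoc]

/-- The memory holds the tables, and the search varies the positions from `i` to `e`, exclusively.
-/
structure Window (V : Fin m → Equiv.Perm (Fin n)) (β : ℕ → ℝ) (μ : Fin n → ℝ) (i e : ℕ)
    (s : Store) : Prop extends Tables V β μ s where
  start : s.nat Reg.start = i
  limit : s.nat Reg.limit = e
  start_le_limit : i ≤ e
  limit_le : e ≤ n

theorem Window.frame {e : ℕ} {P : Program} (h : Window V β μ i e s) (F : Frame P s s')
    (hT : P.keepsTables = true := by rfl)
    (hstart : P.anyOp (Op.writesNat Reg.start) = false := by rfl)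
    (hlimit : P.anyOp (Op.writesNat Reg.limit) = false := by rfl) : Window V β μ i e s' :=
  ⟨h.toTables.frame F hT, (F.nat _ hstart).trans h.start, (F.nat _ hlimit).trans h.limit,
    h.start_le_limit, h.limit_le⟩

theorem run_evalTrial {e : ℕ} (hW : Window V β μ i e s) (hω : Holds Arr.trial ω s) :
    Run evalTrial s ((e - i) * (m * (n * 7 + 18) + 10) + 3) fun s' =>
      s'.real Reg.cost = RankAgg.profileTruncDist β μ ω V (i + 1) e := by
  refine Run.le (T := 1 + ((e - i) * (m * (n * 7 + 18) + 8 + 2) + 2)) (.seq (.op (Q := fun s' =>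
    s'.real Reg.cost = 0) (by simp [Op.apply])) fun s₁ F₁ hcost => ?_) (by lia)
  have hW₁ := hW.frame F₁
  refine Run.forLoop (fun k s' => s'.real Reg.cost = RankAgg.profileTruncDist β μ ω V (i + 1) k)
    hW₁.one hW₁.zero hW₁.start hW₁.limit hW.start_le_limit
    (by rw [hcost, RankAgg.profileTruncDist_succ_self]) ?_
  rintro p s₂ hip hpe hpos F₂ hcost₂
  lift p to Fin n using hpe.trans_le hW.limit_le
  refine (run_addPosition (hW₁.frame F₂).toTables ((hω.frame F₁).frame F₂) hpos).imp
    fun s' _ h => ?_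
  rw [h, hcost₂, RankAgg.profileTruncDist_succ β μ ω V hip]

/-! ## Enumeration of the rankings with a given beginning -/

/-- The ranking that is obtained from `ω` by exchanging, for `r = 0, …, k - 1`, the position `i + r`
with the position `d r`, provided that the latter is not smaller. -/
def extension (ω : Equiv.Perm (Fin n)) (i : ℕ) (d : ℕ → ℕ) : ℕ → Equiv.Perm (Fin n)
  | 0 => ω
  | k + 1 =>
    if h : i + k ≤ d k ∧ d k < n then
      extension ω i d k * Equiv.swap ⟨i + k, h.1.trans_lt h.2⟩ ⟨d k, h.2⟩
    else extension ω i d k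

theorem extension_congr {d d' : ℕ → ℕ} {k : ℕ} (h : ∀ r < k, d r = d' r) :
    extension ω i d k = extension ω i d' k := by
  induction k with
  | zero => rfl
  | succ k ih =>
    simp only [extension, ih fun r hr => h r (hr.trans k.lt_succ_self), h k k.lt_succ_self]

theorem mul_swap_apply_of_lt {p q r : Fin n} (hr : r < p) (hpq : p ≤ q) :
    (ω * Equiv.swap p q) r = ω r := by
  rw [Equiv.Perm.mul_apply, Equiv.swap_apply_of_ne_of_ne hr.ne (hr.trans_le hpq).ne]

theorem extension_agreeBelow (ω : Equiv.Perm (Fin n)) (i : ℕ) (d : ℕ → ℕ) (k : ℕ) :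
    RankAgg.AgreeBelow i (extension ω i d k) ω := by
  induction k with
  | zero => exact fun _ _ => rfl
  | succ k ih =>
    intro p hp
    rw [extension]
    split_ifs with h
    · rw [mul_swap_apply_of_lt (Fin.lt_def.2 (hp.trans_le (i.le_add_right k))) h.1, ih p hp]
    · exact ih p hp

theorem exists_extension_agreeBelow {ω' : Equiv.Perm (Fin n)} (h : RankAgg.AgreeBelow i ω' ω)
    {k : ℕ} (hk : i + k ≤ n) :
    ∃ d : ℕ → ℕ, (∀ r < k, d r < n) ∧ RankAgg.AgreeBelow (i + k) (extension ω i d k) ω' := by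
  induction k with
  | zero => exact ⟨id, fun _ h => absurd h (Nat.not_lt_zero _), h.symm⟩
  | succ k ih =>
    obtain ⟨d, hdn, hd⟩ := ih (by omega)
    set τ := extension ω i d k
    set p : Fin n := ⟨i + k, hk⟩
    set q : Fin n := τ.symm (ω' p)
    have hpq : p ≤ q := by
      by_contra! hlt
      have hq := hd q hlt
      rw [Equiv.apply_symm_apply, ω'.apply_eq_iff_eq] at hq
      exact hlt.ne' hq
    have hlow : extension ω i (Function.update d k q) k = τ :=
      extension_congr fun r hr => by rw [Function.update_of_ne hr.ne]
    have hstep : extension ω i (Function.update d k q) (k + 1) = τ * Equiv.swap p q := by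
      simp only [extension, hlow, Function.update_self]
      exact dif_pos ⟨hpq, q.2⟩
    refine ⟨Function.update d k q, fun r hr => ?_, fun r hr => ?_⟩
    · rcases Nat.lt_succ_iff_lt_or_eq.1 hr with hlt | rfl
      · rw [Function.update_of_ne hlt.ne]
        exact hdn r hlt
      · rw [Function.update_self]
        exact q.2
    rw [hstep]
    rcases Nat.lt_succ_iff_lt_or_eq.1 hr with hlt | heq
    · rw [mul_swap_apply_of_lt hlt hpq, hd r hlt]
    · obtain rfl : r = p := Fin.ext heq
      simp [q]

/-- The `k`-th digit of `T` in base `n`. -/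
def digit (n T k : ℕ) : ℕ := T / n ^ k % n

theorem exists_digit_eq {k : ℕ} {d : ℕ → ℕ} (hd : ∀ r < k, d r < n) :
    ∃ T < n ^ k, ∀ r < k, digit n T r = d r := by
  refine ⟨finFunctionFinEquiv fun r : Fin k => ⟨d r, hd r r.2⟩, Fin.is_lt _, fun r hr => ?_⟩
  rw [digit, ← finFunctionFinEquiv_symm_apply_val _ ⟨r, hr⟩, Equiv.symm_apply_apply]

theorem digit_succ_of_lt {T k c : ℕ} (hc : T / n ^ k + c = (T + 1) / n ^ k)
    (h : digit n T k + c < n) :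
    digit n (T + 1) k = digit n T k + c ∧ T / n ^ (k + 1) = (T + 1) / n ^ (k + 1) := by
  have hdiv := Nat.div_add_mod (T / n ^ k) n
  have hn : 0 < n := by omega
  have hsum : T / n ^ k + c = digit n T k + c + n * (T / n ^ k / n) := by
    rw [digit]
    omega
  rw [digit, pow_succ, ← Nat.div_div_eq_div_mul, ← Nat.div_div_eq_div_mul, ← hc, hsum,
    Nat.add_mul_mod_self_left, Nat.mod_eq_of_lt h, Nat.add_mul_div_left _ _ hn,
    Nat.div_eq_of_lt h, zero_add]
  exact ⟨rfl, rfl⟩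

theorem digit_succ_of_eq {T k c : ℕ} (hn : 0 < n) (hc : T / n ^ k + c = (T + 1) / n ^ k)
    (h : digit n T k + c = n) :
    digit n (T + 1) k = 0 ∧ T / n ^ (k + 1) + 1 = (T + 1) / n ^ (k + 1) := by
  have hdiv := Nat.div_add_mod (T / n ^ k) n
  have hsum : T / n ^ k + c = n * (T / n ^ k / n + 1) := by
    rw [digit] at h
    rw [mul_add, mul_one]
    omega
  rw [digit, pow_succ, ← Nat.div_div_eq_div_mul, ← Nat.div_div_eq_div_mul, ← hc, hsum,
    Nat.mul_mod_right, Nat.mul_div_cancel_left _ hn]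
  exact ⟨rfl, rfl⟩

/-- Exchange the positions in the ranking `base` according to the digits in the array `digits`, and
put the result into the array `trial`. -/
def buildTrial : Program :=
  .seq (copyArr Arr.base Arr.trial)
    (forLoop Reg.pos Reg.start Reg.limit
      (.seq (.op (.natLoad Reg.digit Arr.digits Reg.pos))
        (.ite (.natLt Reg.digit Reg.pos) skip (swapCells Arr.trial Reg.pos Reg.digit))))

/-- Add the register `carry` to a digit. -/
def incrementDigit : Program :=
  .seq (block (.natLoad Reg.digit Arr.digits Reg.pos) [.natAdd Reg.digit Reg.digit Reg.carry])
    (.ite (.natLt Reg.digit Reg.numCand)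
      (block (.natStore Arr.digits Reg.pos Reg.digit) [.natConst Reg.carry 0])
      (block (.natStore Arr.digits Reg.pos Reg.zero) [.natConst Reg.carry 1]))

/-- Increase the number whose digits are in the array `digits`, from the least significant one on.
-/
def nextDigits : Program :=
  .seq (.op (.natConst Reg.carry 1)) (forLoop Reg.pos Reg.start Reg.limit incrementDigit)

/-- For `a ≤ k < b`, the cell `i + k` of the array `digits` holds the `k`-th digit of `T`. -/
def HoldsDigits (n i T a b : ℕ) (s : Store) : Prop :=
  ∀ k, a ≤ k → k < b → s.natArr Arr.digits (i + k) = digit n T k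

theorem run_buildTrial {e T : ℕ} (hW : Window V β μ i e s) (hω : Holds Arr.base ω s)
    (hd : HoldsDigits n i T 0 (e - i) s) :
    Run buildTrial s (n * 4 + (e - i) * 8 + 4)
      (Holds Arr.trial (extension ω i (digit n T) (e - i))) := by
  refine Run.le (T := n * 4 + 2 + ((e - i) * (1 + (4 + 1) + 2) + 2))
    (.seq (run_copyArr (by decide) hW.toTables hω) fun s₁ F₁ hcopy => ?_) (by lia)
  have hW₁ := hW.frame F₁
  refine Run.forLoop (fun p s' => Holds Arr.trial (extension ω i (digit n T) (p - i)) s') hW₁.one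
    hW₁.zero hW₁.start hW₁.limit hW.start_le_limit (by rwa [Nat.sub_self]) ?_
  intro p s₂ hip hp hpos F₂ htrial
  obtain ⟨k, rfl⟩ := Nat.exists_eq_add_of_le hip
  have hpn : i + k < n := hp.trans_le hW.limit_le
  have hdigit : s₂.natArr Arr.digits (i + k) = digit n T k := by
    rw [F₂.natArr _ rfl, F₁.natArr _ rfl, hd k k.zero_le (by omega)]
  have hdn : digit n T k < n := Nat.mod_lt _ (by omega)
  rw [show i + k + 1 - i = k + 1 by omega, extension]
  rw [Nat.add_sub_cancel_left] at htrial
  refine .seq (Q := fun s' => s'.nat Reg.digit = digit n T k) (.op (by simp [Op.apply, hpos,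
    hdigit])) fun s₃ F₃ hreg => .ite_natLt hreg ((F₃.nat _ rfl).trans hpos) (fun hlt => ?_)
      fun hle => ?_
  · rw [dif_neg fun h => hlt.not_ge h.1]
    exact Run.le (.skip (htrial.frame F₃)) (by norm_num)
  · rw [dif_pos ⟨hle, hdn⟩]
    exact run_swapCells (htrial.frame F₃) (p := ⟨i + k, hpn⟩) (q := ⟨digit n T k, hdn⟩)
      ((F₃.nat _ rfl).trans hpos) hreg

theorem run_incrementDigit {T k : ℕ} (hn0 : 0 < n) (hn : s.nat Reg.numCand = n)
    (hzero : s.nat Reg.zero = 0) (hpos : s.nat Reg.pos = i + k)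
    (hd : s.natArr Arr.digits (i + k) = digit n T k) (hle : s.nat Reg.carry ≤ 1)
    (hc : T / n ^ k + s.nat Reg.carry = (T + 1) / n ^ k) :
    Run incrementDigit s 5 fun s' => s'.natArr Arr.digits =
      Function.update (s.natArr Arr.digits) (i + k) (digit n (T + 1) k) ∧
      s'.nat Reg.carry ≤ 1 ∧ T / n ^ (k + 1) + s'.nat Reg.carry = (T + 1) / n ^ (k + 1) := by
  have hdn : digit n T k < n := Nat.mod_lt _ hn0
  refine .seq (T := 2) (T' := 2 + 1)
    (Q := fun s' => s'.nat Reg.digit = digit n T k + s.nat Reg.carry)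
    (.block le_rfl (by simp [Op.apply, hpos, hd])) fun s₁ F₁ hsum => .ite_natLt hsum
      ((F₁.nat _ rfl).trans hn) (fun hlt => .block le_rfl ?_) fun hge => .block le_rfl ?_
  · obtain ⟨hdigit, hcarry⟩ := digit_succ_of_lt hc hlt
    simp [Op.apply, F₁.nat Reg.pos rfl, F₁.natArr Arr.digits rfl, hpos, hsum, hdigit, hcarry]
  · obtain ⟨hdigit, hcarry⟩ := digit_succ_of_eq hn0 hc (by omega)
    simp [Op.apply, F₁.nat Reg.pos rfl, F₁.natArr Arr.digits rfl, F₁.nat Reg.zero rfl, hpos, hzero,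
      hdigit, hcarry]

theorem run_nextDigits {e T : ℕ} (hW : Window V β μ i e s)
    (hd : HoldsDigits n i T 0 (e - i) s) :
    Run nextDigits s ((e - i) * 7 + 3) fun s' => HoldsDigits n i (T + 1) 0 (e - i) s' ∧
      T / n ^ (e - i) + s'.nat Reg.carry = (T + 1) / n ^ (e - i) := by
  refine Run.le (T := 1 + ((e - i) * (5 + 2) + 2)) (.seq (.op (Q := fun s' =>
    s'.nat Reg.carry = 1) (by simp [Op.apply])) fun s₁ F₁ hone => ?_) (by omega)
  have hW₁ := hW.frame F₁
  refine (Run.forLoop (fun p s' => HoldsDigits n i (T + 1) 0 (p - i) s' ∧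
    HoldsDigits n i T (p - i) (e - i) s' ∧ s'.nat Reg.carry ≤ 1 ∧
    T / n ^ (p - i) + s'.nat Reg.carry = (T + 1) / n ^ (p - i)) hW₁.one hW₁.zero hW₁.start hW₁.limit
    hW.start_le_limit ⟨by simp [HoldsDigits], fun k _ hk => ?_, hone.le, by simp [hone]⟩ ?_).imp
    fun s' _ h => ⟨h.1, h.2.2.2⟩
  · rw [F₁.natArr _ rfl, hd k k.zero_le hk]
  intro p s₂ hip hp hpos F₂ ⟨hlow, hhigh, hle, hcarry⟩
  obtain ⟨k, rfl⟩ := Nat.exists_eq_add_of_le hip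
  rw [Nat.add_sub_cancel_left] at hlow hhigh hcarry
  rw [show i + k + 1 - i = k + 1 by omega]
  have hW₂ := hW₁.frame F₂
  refine (run_incrementDigit (by have := hW.limit_le; omega) hW₂.numCand hW₂.zero hpos
    (hhigh k le_rfl (by omega)) hle hcarry).imp fun s' _ ⟨harr, hc⟩ =>
      ⟨fun r _ hr => ?_, fun r hkr hr => ?_, hc⟩
  · rcases Nat.lt_succ_iff_lt_or_eq.1 hr with hlt | rfl
    · rw [harr, Function.update_of_ne (by omega), hlow r r.zero_le hlt]
    · rw [harr, Function.update_self]
  · rw [harr, Function.update_of_ne (by omega), hhigh r (by omega) hr]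

/-! ## The search -/

/-- Record the ranking `trial` as the best one so far. -/
def saveTrial : Program :=
  .seq (copyArr Arr.trial Arr.output)
    (block (.realConst Reg.factor 0) [.realAdd Reg.bestCost Reg.cost Reg.factor])

/-- Record the ranking `trial` if it is better than all the previous ones. -/
def keepBetter : Program :=
  .ite (.realLt Reg.cost Reg.bestCost) saveTrial skip

/-- Record the ranking `base` as the best one so far, and set all digits to `0`. -/
def initSearch : Program :=
  .seq (copyArr Arr.base Arr.trial) (.seq evalTrial (.seq saveTrial
    (.seq (forLoop Reg.pos Reg.start Reg.limit (.op (.natStore Arr.digits Reg.pos Reg.zero)))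
      (.op (.natConst Reg.carry 0)))))

/-- Try the ranking that the digits describe. -/
def searchStep : Program :=
  .seq buildTrial (.seq evalTrial (.seq keepBetter nextDigits))

/-- Find a ranking that is optimal on the positions from `start` to `limit`, exclusively, among the
rankings that agree with `base` before `start`. -/
def search : Program :=
  .seq initSearch (.loop (.natLt Reg.carry Reg.one) searchStep)

/-- The array `output` holds a ranking that agrees with `ω` before the position `i`, and the
register `bestCost` holds its distance to the profile, truncated to the positions from `i` to `e`,
exclusively. -/
def HoldsRecord (V : Fin m → Equiv.Perm (Fin n)) (β : ℕ → ℝ) (μ : Fin n → ℝ) (i e : ℕ)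
    (ω : Equiv.Perm (Fin n)) (s : Store) : Prop :=
  ∃ σ : Equiv.Perm (Fin n), Holds Arr.output σ s ∧ RankAgg.AgreeBelow i σ ω ∧
    s.real Reg.bestCost = RankAgg.profileTruncDist β μ σ V (i + 1) e

theorem HoldsRecord.frame {e : ℕ} {P : Program} (h : HoldsRecord V β μ i e ω s) (F : Frame P s s')
    (hout : P.anyOp (Op.writesNatArr Arr.output) = false := by rfl)
    (hbest : P.anyOp (Op.writesReal Reg.bestCost) = false := by rfl) :
    HoldsRecord V β μ i e ω s' := by
  obtain ⟨σ, hσ, hagree, hcost⟩ := h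
  exact ⟨σ, hσ.frame F hout, hagree, (F.real _ hbest).trans hcost⟩

/-- The memory represents the state of the search after `T` rounds. -/
structure SearchState (V : Fin m → Equiv.Perm (Fin n)) (β : ℕ → ℝ) (μ : Fin n → ℝ) (i e : ℕ)
    (ω : Equiv.Perm (Fin n)) (T : ℕ) (s : Store) : Prop extends Window V β μ i e s where
  base : Holds Arr.base ω s
  digits : HoldsDigits n i T 0 (e - i) s
  carry : s.nat Reg.carry = T / n ^ (e - i)
  record : HoldsRecord V β μ i e ω s
  bestCost_le : ∀ T' < T, s.real Reg.bestCost ≤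
    RankAgg.profileTruncDist β μ (extension ω i (digit n T') (e - i)) V (i + 1) e

theorem run_saveTrial {e : ℕ} {σ : Equiv.Perm (Fin n)} (hT : Tables V β μ s)
    (hσ : Holds Arr.trial σ s) (hagree : RankAgg.AgreeBelow i σ ω)
    (hcost : s.real Reg.cost = RankAgg.profileTruncDist β μ σ V (i + 1) e) :
    Run saveTrial s (n * 4 + 4) fun s' => HoldsRecord V β μ i e ω s' ∧
      s'.real Reg.bestCost = s.real Reg.cost := by
  refine .seq (T := n * 4 + 2) (T' := 2)
    (Q := fun s' => Holds Arr.output σ s' ∧ s'.real Reg.cost = s.real Reg.cost)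
    ((run_copyArr (by decide) hT hσ).imp fun s' F h => ⟨h, F.real _ rfl⟩)
    fun s₁ _ ⟨hout, hreg⟩ => .block le_rfl ⟨⟨σ, hout, hagree, ?_⟩, ?_⟩
  · simp [Op.apply, hreg, hcost]
  · simp [Op.apply, hreg]

theorem run_keepBetter {e : ℕ} {σ : Equiv.Perm (Fin n)} (hT : Tables V β μ s)
    (hσ : Holds Arr.trial σ s) (hagree : RankAgg.AgreeBelow i σ ω)
    (hcost : s.real Reg.cost = RankAgg.profileTruncDist β μ σ V (i + 1) e)
    (hrec : HoldsRecord V β μ i e ω s) :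
    Run keepBetter s (n * 4 + 5) fun s' => HoldsRecord V β μ i e ω s' ∧
      s'.real Reg.bestCost ≤ s.real Reg.bestCost ∧ s'.real Reg.bestCost ≤ s.real Reg.cost := by
  refine .ite_realLt rfl rfl (fun hlt => (run_saveTrial hT hσ hagree hcost).imp fun s' _ h =>
    ⟨h.1, h.2.trans_le hlt.le, h.2.le⟩) fun hle => Run.le (T := 1)
      (.skip ⟨hrec, le_rfl, hle⟩) (by omega)

theorem run_initSearch {e : ℕ} (hW : Window V β μ i e s) (hω : Holds Arr.base ω s) :
    Run initSearch s (n * 8 + (e - i) * (m * (n * 7 + 18) + 13) + 12)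
      (SearchState V β μ i e ω 0) := by
  refine Run.le (T := n * 4 + 2 + ((e - i) * (m * (n * 7 + 18) + 10) + 3 + (n * 4 + 4 +
    ((e - i) * (1 + 2) + 2 + 1)))) (.seq (run_copyArr (by decide) hW.toTables hω) fun s₁ F₁ h₁ =>
      .seq (run_evalTrial (hW.frame F₁) h₁) fun s₂ F₂ hcost =>
        .seq (run_saveTrial ((hW.frame F₁).frame F₂).toTables (h₁.frame F₂) (fun _ _ => rfl) hcost)
          fun s₃ F₃ hrec => ?_) (by lia)
  have hW₃ := ((hW.frame F₁).frame F₂).frame F₃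
  refine .seq (Run.forLoop (fun p s' => HoldsDigits n i 0 0 (p - i) s') hW₃.one hW₃.zero hW₃.start
    hW₃.limit hW.start_le_limit (by simp [HoldsDigits])
      fun p s' hip _ hpos F h => .op fun k _ hk => ?_)
    fun s₄ F₄ hdigits => .op ?_
  · rcases eq_or_ne p (i + k) with rfl | hne
    · simp [Op.apply, hpos, (hW₃.frame F).zero, digit]
    · simp [Op.apply, hpos, hne.symm, h k k.zero_le (by omega)]
  have F := F₄.seq (.op (.natConst Reg.carry 0) s₄)
  exact ⟨hW₃.frame F, (((hω.frame F₁).frame F₂).frame F₃).frame F, hdigits, by simp [Op.apply],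
    hrec.1.frame F, fun _ h => absurd h (Nat.not_lt_zero _)⟩

theorem run_searchStep {e T : ℕ} (h : SearchState V β μ i e ω T s) (hT : T < n ^ (e - i)) :
    Run searchStep s (n * 8 + (e - i) * (m * (n * 7 + 18) + 25) + 15)
      (SearchState V β μ i e ω (T + 1)) := by
  refine Run.le (T := n * 4 + (e - i) * 8 + 4 + ((e - i) * (m * (n * 7 + 18) + 10) + 3 +
    (n * 4 + 5 + ((e - i) * 7 + 3)))) (.seq (run_buildTrial h.toWindow h.base h.digits)
      fun s₁ F₁ h₁ => .seq (run_evalTrial (h.toWindow.frame F₁) h₁) fun s₂ F₂ hcost =>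
        .seq (run_keepBetter ((h.toWindow.frame F₁).frame F₂).toTables (h₁.frame F₂)
          (extension_agreeBelow _ _ _ _) hcost ((h.record.frame F₁).frame F₂))
            fun s₃ F₃ ⟨hrec, hle_best, hle_cost⟩ => ?_) (by lia)
  have F := F₁.seq (F₂.seq F₃)
  refine (run_nextDigits (T := T) (h.toWindow.frame F) fun k h0 hk => ?_).imp
    fun s₄ F₄ ⟨hdigits, hcarry⟩ => ⟨(h.toWindow.frame F).frame F₄, (h.base.frame F).frame F₄,
      hdigits, by rwa [Nat.div_eq_of_lt hT, zero_add] at hcarry, hrec.frame F₄, fun T' hT' => ?_⟩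
  · rw [F.natArr _ rfl, h.digits k h0 hk]
  rw [F₄.real _ rfl]
  rcases Nat.lt_succ_iff_lt_or_eq.1 hT' with hlt | rfl
  · rw [F₂.real _ rfl, F₁.real _ rfl] at hle_best
    exact hle_best.trans (h.bestCost_le T' hlt)
  · exact hle_cost.trans hcost.le

theorem run_search {e : ℕ} (hW : Window V β μ i e s) (hω : Holds Arr.base ω s) :
    Run search s ((n ^ (e - i) + 1) * (n * 8 + (e - i) * (m * (n * 7 + 18) + 25) + 16)) fun s' =>
      ∃ σ : Equiv.Perm (Fin n), Holds Arr.output σ s' ∧ RankAgg.AgreeBelow i σ ω ∧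
        ∀ σ', RankAgg.AgreeBelow i σ' ω → RankAgg.profileTruncDist β μ σ V (i + 1) e ≤
          RankAgg.profileTruncDist β μ σ' V (i + 1) e := by
  set N := n ^ (e - i)
  have hen : i + (e - i) ≤ n := by rw [Nat.add_sub_cancel' hW.start_le_limit]; exact hW.limit_le
  have hN : 0 < N := by
    rcases n.eq_zero_or_pos with rfl | hn
    · simp [N, show e - i = 0 by omega]
    · exact Nat.pow_pos hn
  refine Run.le (T := n * 8 + (e - i) * (m * (n * 7 + 18) + 13) + 12 +
    (N * (n * 8 + (e - i) * (m * (n * 7 + 18) + 25) + 15 + 1) + 1))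
    (.seq (run_initSearch hW hω) fun s₁ _ h₁ => .loop (fun v s' => ∃ T, v = N - T ∧
      SearchState V β μ i e ω T s') ?_ ?_ ⟨0, rfl, h₁⟩) (by lia)
  · rintro v s' ⟨T, rfl, h⟩ hlt
    have hTN : T < N := by
      simp only [Test.Holds, h.carry, h.one, Nat.lt_one_iff, Nat.div_eq_zero_iff] at hlt
      exact hlt.resolve_left hN.ne'
    exact (run_searchStep h hTN).imp fun s'' _ h' => ⟨N - (T + 1), by omega, T + 1, rfl, h'⟩
  · rintro v s' ⟨T, rfl, h⟩ hlt
    obtain ⟨σ, hσ, hagree, hcost⟩ := h.record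
    refine ⟨σ, hσ, hagree, fun σ' hσ' => ?_⟩
    have hNT : N ≤ T := by
      simp only [Test.Holds, h.carry, h.one, Nat.lt_one_iff, Nat.div_eq_zero_iff] at hlt
      omega
    obtain ⟨d, hd, hext⟩ := exists_extension_agreeBelow hσ' hen
    obtain ⟨T', hT', hdigit⟩ := exists_digit_eq hd
    rw [← extension_congr hdigit, Nat.add_sub_cancel' h.start_le_limit] at hext
    rw [← hcost, ← hext.profileTruncDist_eq]
    exact h.bestCost_le T' (hT'.trans_le hNT)

/-! ## The whole program -/

/-- Set up the constants and the tables. -/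
def preprocess : Program :=
  .seq (block (.natConst Reg.one 1) [.natConst Reg.zero 0]) (.seq voterPositions fTable)

/-- Set `limit` to the smaller of `start + depth` and `numCand`. -/
def setWindow : Program :=
  .seq (.op (.natAdd Reg.limit Reg.start Reg.depth))
    (.ite (.natLt Reg.limit Reg.numCand) skip (.op (.natAdd Reg.limit Reg.numCand Reg.zero)))

/-- A program for Algorithm MyopicTop. -/
def myopicTop : Program :=
  .seq preprocess (.seq majorityPhase (.seq setWindow search))

theorem inputStore_votes {K : ℕ} (j : Fin m) (p : Fin n) :
    (inputStore K V β μ).natArr Arr.votes (j * n + p) = V j p := by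
  have hdiv : (j * n + p : ℕ) / n = j := by
    rw [mul_comm, Nat.mul_add_div p.pos, Nat.div_eq_of_lt p.2, add_zero]
  have hmod : (j * n + p : ℕ) % n = p := by
    rw [Nat.mul_add_mod_self_right, Nat.mod_eq_of_lt p.2]
  simp [inputStore, hdiv, hmod]

theorem run_preprocess {K : ℕ} (hn : 1 ≤ n) :
    Run preprocess (inputStore K V β μ) (2 + (m * (n * 6 + 5) + 3 + (n * (n * 7 + 6) + 2)))
      (Tables V β μ) := by
  refine .seq (Q := fun s' => s'.nat Reg.one = 1 ∧ s'.nat Reg.zero = 0) (.block le_rfl ⟨rfl, rfl⟩)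
    fun s₁ F₁ ⟨hone, hzero⟩ => .seq (run_voterPositions (V := V) (F₁.nat _ rfl) (F₁.nat _ rfl)
      hone hzero (by rw [F₁.natArr _ rfl]; exact inputStore_votes)) fun s₂ F₂ hpos => ?_
  have F := F₁.seq F₂
  refine (run_fTable (β := β) hn (F.nat _ rfl) ((F₂.nat _ rfl).trans hone)
    ((F₂.nat _ rfl).trans hzero) (by simp [F.realArr Arr.weights rfl, inputStore])
    fun k hk hkn => by simp [F.realArr Arr.weights rfl, inputStore, hk, hkn]).imp
    fun s₃ F₃ hf => ?_
  have F' := F.seq F₃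
  refine ⟨F'.nat _ rfl, F'.nat _ rfl, ((F₂.seq F₃).nat _ rfl).trans hone,
    ((F₂.seq F₃).nat _ rfl).trans hzero, ?_, ?_, fun x => ?_, hf⟩
  · rw [F'.natArr _ rfl]; exact inputStore_votes
  · rw [F₃.natArr _ rfl]; exact hpos
  · simp [F'.realArr Arr.measure rfl, inputStore]

theorem run_setWindow {l : List (Fin n)} {K : ℕ} (hT : Tables V β μ s)
    (h : MajorityState V ω l Q s) (hK : s.nat Reg.depth = K) :
    Run setWindow s 3 (Window V β μ l.length (l.length + min K Q.card)) := by
  have hcard := h.reaches.card_add_length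
  have hW {s' : Store} (F : Frame setWindow s s')
      (hlimit : s'.nat Reg.limit = l.length + min K Q.card) :
      Window V β μ l.length (l.length + min K Q.card) s' :=
    ⟨hT.frame F, (F.nat _ rfl).trans h.start, hlimit, by omega, by omega⟩
  refine (Run.seq (T := 1) (T' := 1 + 1) (.op (Q := fun s' => s'.nat Reg.limit = l.length + K)
    (by simp [Op.apply, h.start, hK])) fun s₁ F₁ hsum => .ite_natLt
      (Q := fun s' => s'.nat Reg.limit = l.length + min K Q.card) hsum
      ((F₁.nat _ rfl).trans hT.numCand) (fun hlt => .skip (hsum.trans (by omega)))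
      fun hle => .op ?_).imp fun s' F hlimit => hW F hlimit
  simp only [Op.apply, Function.update_self, (hT.frame F₁).numCand, (hT.frame F₁).zero]
  omega

theorem isMyopicTopOutput_of_agreeBelow {K : ℕ} {σ : Equiv.Perm (Fin n)} {l : List (Fin n)}
    (hl : RankAgg.LoopReaches V l Q) (hno : ¬ ∃ c, RankAgg.IsMajority V Q c)
    (hω : RankAgg.StartsWith ω l) (hσ : RankAgg.AgreeBelow l.length σ ω)
    (hmin : ∀ σ', RankAgg.AgreeBelow l.length σ' ω →
      RankAgg.profileTruncDist β μ σ V (l.length + 1) (l.length + min K Q.card) ≤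
        RankAgg.profileTruncDist β μ σ' V (l.length + 1) (l.length + min K Q.card)) :
    RankAgg.IsMyopicTopOutput K V β μ σ :=
  ⟨l, Q, hl, hno, fun p hp => (hσ p hp).trans (hω p hp), fun σ' hσ' => hmin σ' (hσ'.agreeBelow hω)⟩

/-- The constant is the value of the left-hand side for `n = m = K = 1`. -/
theorem myopicTop_time_le {K : ℕ} (hn : 1 ≤ n) (hm : 1 ≤ m) (hK : 1 ≤ K) :
    2 + (m * (n * 6 + 5) + 3 + (n * (n * 7 + 6) + 2)) +
      (n * (n * 9 + m * (n * 10 + 9) + 18) + 5 +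
        (3 + (n ^ K + 1) * (n * 8 + K * (m * (n * 7 + 18) + 25) + 16))) ≤
      233 * (n ^ (K + 1) * m * K) := by
  have hP : n ≤ n ^ K := Nat.le_self_pow (by omega) n
  rw [pow_succ]
  generalize n ^ K = P at hP
  obtain ⟨a, rfl⟩ := Nat.exists_eq_add_of_le hn
  obtain ⟨b, rfl⟩ := Nat.exists_eq_add_of_le hm
  obtain ⟨c, rfl⟩ := Nat.exists_eq_add_of_le hK
  obtain ⟨r, rfl⟩ := Nat.exists_eq_add_of_le hP
  ring_nf
  omega

theorem run_myopicTop {K : ℕ} (hn : 1 ≤ n) (hm : 1 ≤ m) (hK : 1 ≤ K)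
    (V : Fin m → Equiv.Perm (Fin n)) (β : ℕ → ℝ) (μ : Fin n → ℝ) :
    Run myopicTop (inputStore K V β μ) (233 * (n ^ (K + 1) * m * K)) fun s' =>
      ∃ σ : Equiv.Perm (Fin n), Holds Arr.output σ s' ∧ RankAgg.IsMyopicTopOutput K V β μ σ := by
  refine Run.le (.seq (run_preprocess hn) fun s₁ F₁ hT => .seq (run_majorityPhase hT)
    fun s₂ F₂ ⟨ω, l, Q, h, hno⟩ => .seq (run_setWindow (hT.frame F₂) h (K := K)
      ((F₁.seq F₂).nat Reg.depth rfl)) fun s₃ F₃ hW => ?_) (myopicTop_time_le hn hm hK)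
  have hd : l.length + min K Q.card - l.length ≤ K := by omega
  refine ((run_search hW (h.base.frame F₃)).le ?_).imp fun s₄ _ ⟨σ, hσ, hagree, hmin⟩ =>
    ⟨σ, hσ, isMyopicTopOutput_of_agreeBelow h.reaches hno h.startsWith hagree hmin⟩
  gcongr

theorem exists_runsMyopicTop_myopicTop {K : ℕ} (hn : 1 ≤ n) (hm : 1 ≤ m) (hK : 1 ≤ K)
    (V : Fin m → Equiv.Perm (Fin n)) (β : ℕ → ℝ) (μ : Fin n → ℝ) :
    ∃ t ≤ 233 * (n ^ (K + 1) * m * K), RunsMyopicTop myopicTop K V β μ t := by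
  obtain ⟨s', t, hexec, ht, σ, hσ, hout⟩ := run_myopicTop hn hm hK V β μ
  exact ⟨t, ht, s', σ, hexec, hσ, hout⟩

end

end RealRAM

theorem mainTheorem7 :
    ∃ (P : RealRAM.Program) (C : ℕ),
      RealRAM.ImplementsMyopicTop P ∧
      ∀ (β : ℕ → ℝ),
        (∀ k, 2 ≤ k → 0 ≤ β k) → 0 < β 2 →
        Tendsto (RankAgg.growthSup β) atTop (𝓝 0) →
      ∀ (μ : (k : ℕ) → Fin k → ℝ) (u U : ℝ),
        0 < u → (∀ k, 2 ≤ k → ∀ i, u ≤ μ k i ∧ μ k i ≤ U) →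
      ∀ (ε : ℝ), 0 < ε →
      ∀ (K : ℕ), K = RankAgg.depth β (12 * U / (u * ε)) →
        K ∈ RankAgg.depthSet β (u * ε / (12 * U)) ∧
        ∀ (n m : ℕ), 2 ≤ n → 1 ≤ m → ∀ (V : Fin m → Equiv.Perm (Fin n)),
          (∀ σapx σstar : Equiv.Perm (Fin n),
            RankAgg.IsMyopicTopOutput K V β (μ n) σapx →
            RankAgg.IsConsensus β (μ n) V σstar →
            RankAgg.profileDist β (μ n) σapx V ≤
              (1 + ε) * RankAgg.profileDist β (μ n) σstar V) ∧
          ∃ t : ℕ, t ≤ C * (n ^ (K + 1) * m * K) ∧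
            RealRAM.RunsMyopicTop P K V β (μ n) t := by
  refine ⟨RealRAM.myopicTop, 233, fun n m K V β μ hn hm hK _ _ => ?_, ?_⟩
  · obtain ⟨t, -, hrun⟩ := RealRAM.exists_runsMyopicTop_myopicTop (by omega) hm hK V β μ
    exact ⟨t, hrun⟩
  intro β hβ hβ2 hlim μ u U hu hμ ε hε K hK
  have hU : 0 < U := hu.trans_le ((hμ 2 le_rfl 0).1.trans (hμ 2 le_rfl 0).2)
  have hdepth : K ∈ RankAgg.depthSet β (u * ε / (12 * U)) := by
    rw [hK, ← one_div_div]
    exact RankAgg.depth_mem_depthSet hlim (by positivity)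
  refine ⟨hdepth, fun n m hn hm V => ⟨fun σapx σstar hσapx _ => ?_,
    RealRAM.exists_runsMyopicTop_myopicTop (by omega) hm hdepth.1 V β (μ n)⟩⟩
  have hdist := RankAgg.profileDist_nonneg hβ (fun x => hu.le.trans (hμ n hn x).1) σstar V
  refine (hσapx.profileDist_le hβ hβ2 hu (by positivity) hU.le (hμ n hn) hdepth.2 σstar).trans ?_
  gcongr
  calc 2 * U * (u * ε / (12 * U)) / u = ε / 6 := by field_simp; norm_num
    _ ≤ ε := by linarith
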